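/- **Setting.** Consider the unit square grid in the Euclidean plane; its unit edges are called walls, its vertices (the points of $\mathbb{Z}^2$) corners, and initially all walls are solid. A particle starts at a point $P$ of the plane and moves up and to the right with slope $s>0$, in a straight line until it meets a solid wall; it then reflects off that wall (angle of incidence equal to angle of reflection), and exactly that wall is erased (single-wall bomb). If the particle reaches a corner, it stops, whether or not the walls there are still solid. Each erasure is called a collision. A *band* is the set of points within a given finite distance of a ray. A particle with infinitely many collisions *tunnels* if, for some $r$, every wall collided with outside the disc of radius $r$ (about the origin) is contained in one of finitely many bands; the bands of the tunnel are such a family with the least possible number of bands (over all $r$). The *slope of the tunnel* is the absolute value of the slope of the rays that define its bands. The tunnel is *periodic* if for all sufficiently large $r$ there is an integer $k\ge 1$ such that, whenever the wall hit in collision $n$ lies outside the disc of radius $r$, the wall hit in collision $n+k$ is of the same type (horizontal or vertical) as the wall hit in collision $n$, and the displacement from the latter to the former depends only on which band contains the wall hit in collision $n$. Otherwise the tunnel is *aperiodic*. **Theorem.** Let $P$ be a point in the interior $(0,1)\times(0,1)$ of the unit square. There is an $\varepsilon=\varepsilon(P)$ with $0<\varepsilon\le \frac1{17}$ such that: 1.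 the set of slopes $s\in[3,3+\varepsilon]$ for which the particle starting from $P$ hits a corner is countable; 2. for every other slope $s\in[3,3+\varepsilon]$ the particle starting from $P$ tunnels, and the tunnel has slope $1+\frac{3s-9}{25-8s}$; the tunnel is periodic if $s$ is rational, and aperiodic if $s$ is irrational; 3. consequently uncountably many slopes $s\in[3,3+\varepsilon]$ produce aperiodic tunnels from $P$, and these aperiodic tunnels form an uncountable family, in that uncountably many different sets of erased walls occur. -/

import Mathlib

open Set Filter

/-!  Billiards on the unit square grid with the single-wall bomb: the particle reflects off every
solid wall that it hits and erases exactly that wall. -/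

namespace Breakout

noncomputable section

/-- The Euclidean plane. -/
abbrev Plane : Type := EuclideanSpace ℝ (Fin 2)

/-- The type of a wall. -/
inductive Orientation : Type
  | horizontal
  | vertical

/-- A wall is a unit edge of the square grid, given by its orientation and by its left
(resp. lower) endpoint `(x, y)`. -/
structure Wall : Type where
  orientation : Orientation
  x : ℤ
  y : ℤ

/-- The far endpoint of a wall: right for a horizontal wall, upper for a vertical one. -/
def Wall.farEnd (w : Wall) : Plane :=
  match w.orientation with
  | .horizontal => !₂[(w.x : ℝ) + 1, (w.y : ℝ)]
  | .vertical => !₂[(w.x : ℝ), (w.y : ℝ) + 1]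

/-- A wall as a closed unit segment of the plane. -/
def Wall.toSet (w : Wall) : Set Plane :=
  segment ℝ !₂[(w.x : ℝ), (w.y : ℝ)] w.farEnd

/-- The translation vector from the position of `w` to the position of `w'`. -/
def Wall.displacement (w w' : Wall) : ℤ × ℤ := (w'.x - w.x, w'.y - w.y)

/-- `a` is an integer. -/
def IsInt (a : ℝ) : Prop := ∃ n : ℤ, a = n

/-- A corner is a point of the integer lattice. -/
def IsCorner (q : Plane) : Prop := IsInt (q 0) ∧ IsInt (q 1)

/-- A state of the system: position and velocity of the particle, and the set of solid walls. -/
structure State : Type where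
  pos : Plane
  vel : Plane
  solid : Set Wall

/-- The time until the next encounter: the first strictly positive time at which straight motion
brings one of the coordinates to an integer value. (For a velocity with two nonzero components,
the only kind used below, this infimum is a minimum.) -/
def State.encounterTime (st : State) : ℝ :=
  sInf {t : ℝ | 0 < t ∧ (IsInt (st.pos 0 + t * st.vel 0) ∨ IsInt (st.pos 1 + t * st.vel 1))}

/-- The point at which the next encounter takes place. -/
def State.encounterPoint (st : State) : Plane := st.pos + st.encounterTime • st.vel

open Classical in
/-- The wall through a grid point `q` that is not a corner. -/
def wallAt (q : Plane) : Wall :=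
  if IsInt (q 0) then ⟨.vertical, ⌊q 0⌋, ⌊q 1⌋⟩ else ⟨.horizontal, ⌊q 0⌋, ⌊q 1⌋⟩

/-- The velocity after reflection off a wall of the given orientation. -/
def reflect (o : Orientation) (v : Plane) : Plane :=
  match o with
  | .horizontal => !₂[v 0, -(v 1)]
  | .vertical => !₂[-(v 0), v 1]

/-- The next encounter is a collision: the particle has not been stopped in a corner, it does not
hit a corner now, and the wall that it reaches is still solid. -/
def State.Collides (st : State) : Prop :=
  ¬ IsCorner st.pos ∧ ¬ IsCorner st.encounterPoint ∧ wallAt st.encounterPoint ∈ st.solid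

open Classical in
/-- Motion up to and including the next encounter. A particle in a corner is stopped; a particle
that collides with a solid wall reflects off it and erases it; otherwise it keeps its velocity. -/
def State.step (st : State) : State :=
  if IsCorner st.pos then st
  else if st.Collides then
    { pos := st.encounterPoint
      vel := reflect (wallAt st.encounterPoint).orientation st.vel
      solid := st.solid \ {wallAt st.encounterPoint} }
  else { st with pos := st.encounterPoint }

/-- The particle starts at `P`, moving up and to the right with slope `s`; all walls are solid. -/
def start (P : Plane) (s : ℝ) : State where
  pos := P
  vel := !₂[1, s]
  solid := univ

/-- The state after `n` encounters. -/
def orbit (P : Plane) (s : ℝ) (n : ℕ) : State := State.step^[n] (start P s)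

/-- The particle hits a corner at some time. -/
def HitsCorner (P : Plane) (s : ℝ) : Prop := ∃ n, IsCorner (orbit P s n).pos

/-- The set of `n` for which the encounter following the state `orbit P s n` is a collision. -/
def collisionTimes (P : Plane) (s : ℝ) : Set ℕ := {n | (orbit P s n).Collides}

/-- The wall hit in the `n`-th collision (counting from `0`), when there are infinitely many. -/
def collisionWall (P : Plane) (s : ℝ) (n : ℕ) : Wall :=
  wallAt (orbit P s (Nat.nth (· ∈ collisionTimes P s) n)).encounterPoint

/-- The set of walls that the particle erases. -/
def erasedWalls (P : Plane) (s : ℝ) : Set Wall :=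
  {w | ∃ n ∈ collisionTimes P s, wallAt (orbit P s n).encounterPoint = w}

/-- The data of a band: a ray, given by its origin and a nonzero direction vector, and a width. -/
structure Band : Type where
  origin : Plane
  dir : Plane
  dir_ne_zero : dir ≠ 0
  width : ℝ

/-- The ray that defines a band. -/
def Band.ray (B : Band) : Set Plane := {q | ∃ t : ℝ, 0 ≤ t ∧ q = B.origin + t • B.dir}

/-- The points of the plane within distance `B.width` of the ray. -/
def Band.toSet (B : Band) : Set Plane := Metric.cthickening B.width B.ray

/-- The ray of the band has a slope, and the absolute value of that slope is `m`. -/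
def Band.HasAbsSlope (B : Band) (m : ℝ) : Prop := B.dir 0 ≠ 0 ∧ |B.dir 1 / B.dir 0| = m

/-- The wall lies outside the closed disc of radius `r` about the origin. -/
def Wall.OutsideDisc (w : Wall) (r : ℝ) : Prop := Disjoint w.toSet (Metric.closedBall 0 r)

/-- Every wall collided with outside the disc of radius `r` is contained in one of the bands. -/
def CoversOutside (P : Plane) (s : ℝ) {N : ℕ} (b : Fin N → Band) (r : ℝ) : Prop :=
  ∀ w ∈ erasedWalls P s, w.OutsideDisc r → ∃ i, w.toSet ⊆ (b i).toSet

/-- The bands `b` form a tunnel dug by the particle: the orbit is infinite, the bands contain all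
the walls collided with outside some disc, and no smaller number of bands does so (for a disc
of any size). -/
def IsTunnel (P : Plane) (s : ℝ) {N : ℕ} (b : Fin N → Band) : Prop :=
  (collisionTimes P s).Infinite ∧ (∃ r, CoversOutside P s b r) ∧
    ∀ (M : ℕ) (b' : Fin M → Band), (∃ r, CoversOutside P s b' r) → N ≤ M

/-- The particle tunnels. -/
def Tunnels (P : Plane) (s : ℝ) : Prop := ∃ (N : ℕ) (b : Fin N → Band), IsTunnel P s b

/-- The particle digs a tunnel of slope `m`. -/
def TunnelsWithSlope (P : Plane) (s m : ℝ) : Prop :=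
  ∃ (N : ℕ) (b : Fin N → Band), IsTunnel P s b ∧ ∀ i, (b i).HasAbsSlope m

/-- The particle digs a periodic tunnel: for all sufficiently large `r` there is `k ≥ 1` such that,
for walls outside the disc of radius `r`, the wall hit in collision `n + k` is of the same
type as the wall hit in collision `n`, and the displacement from `n` to `n + k` depends only on the
band that contains wall `n`. -/
def TunnelsPeriodically (P : Plane) (s : ℝ) : Prop :=
  ∃ (N : ℕ) (b : Fin N → Band), IsTunnel P s b ∧
    ∀ᶠ r : ℝ in atTop, ∃ k : ℕ, 0 < k ∧ ∃ d : Fin N → ℤ × ℤ,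
      ∀ n, (collisionWall P s n).OutsideDisc r →
        (collisionWall P s (n + k)).orientation = (collisionWall P s n).orientation ∧
        ∀ i, (collisionWall P s n).toSet ⊆ (b i).toSet →
          (collisionWall P s n).displacement (collisionWall P s (n + k)) = d i

/-- The particle digs a tunnel that is not periodic. -/
def TunnelsAperiodically (P : Plane) (s : ℝ) : Prop :=
  Tunnels P s ∧ ¬ TunnelsPeriodically P s

end

end Breakout

/-!
Unfold the trajectory, so that it becomes a straight line of slope `s = 3 + e` that crosses the grid
lines of the plane. Which kind of grid line is crossed next depends only on the line and not on the
walls, and all that the walls do is to decide, at each crossing, whether the particle passes or is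
reflected. Hence the billiard is a finite automaton moving from cell to cell (`advance`), which
reads the sequence of crossings (`Tracks.vertical`, `Tracks.horizontal`, `Tracks.word`). Between
two vertical grid lines the line crosses three horizontal ones, or four if its height above the last
horizontal line would pass `1`; so these heights form an orbit of the rotation by `e`, and the
height `1` means a corner. In particular only countably many slopes lead to corners
(`countable_hitsCorner`).

If `e` is small, depending on the starting point, then the first four-fold column comes late, and by
then the automaton has reached, in one of four orientations, a configuration from which only the
walls ahead and a few walls behind matter (`baseKnowledge`, `renews_initial`). This configuration is
renewed by every block of crossings: a short block of three ordinary columns moves it by `(1, 1)`, a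
long block of 17 columns, one of the first three of them four-fold, by `(3, 4)` (`Kind.renews`). The
finitely many runs of the automaton that this takes are computed by `simulate`, whose result does
not depend on the place of the block (`advanceWord_of_simulate`).

A short block adds `3 e` to the height, a long one `17 e - 1`, so `Y (1 - 8 e) - X (1 - 5 e) + h` is
invariant, where `(X, Y)` is the position of a block and `h` its height (`Frame.level_shift`). As the
heights are bounded, all the erased walls lie near one ray, whose slope is
`(1 - 5 e) / (1 - 8 e)` in absolute value (`Cruise.staysNear`). For rational `s` the heights take
finitely many values, some height recurs, and from then on the collisions repeat
(`Cruise.exists_same_height`, `Cruise.future`, `exists_period`). For irrational `s` the slope of the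
tunnel is irrational, whereas a period would put erased walls into an arithmetic progression, which
has a rational slope (`not_tunnelsPeriodically`). Finally, an infinite set of walls is near at most
one slope (`NearSlope.unique`), so different slopes give different sets of erased walls.
-/

namespace Breakout

instance : DecidableEq Orientation := fun a b =>
  match a, b with
  | .horizontal, .horizontal => isTrue rfl
  | .vertical, .vertical => isTrue rfl
  | .horizontal, .vertical => isFalse (fun h => by cases h)
  | .vertical, .horizontal => isFalse (fun h => by cases h)

instance : DecidableEq Wall := fun a b =>
  decidable_of_iff (a.orientation = b.orientation ∧ a.x = b.x ∧ a.y = b.y)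
    ⟨fun h => by cases a; cases b; simp_all, fun h => by subst h; simp⟩

/-! ### The cell automaton -/

/-- The combinatorial position of the particle: the cell `[x, x + 1] × [y, y + 1]` that it is about
to traverse, and its heading (rightwards or leftwards, upwards or downwards). -/
structure Pose : Type where
  x : ℤ
  y : ℤ
  right : Bool
  up : Bool

instance : DecidableEq Pose := fun a b =>
  decidable_of_iff (a.x = b.x ∧ a.y = b.y ∧ a.right = b.right ∧ a.up = b.up)
    ⟨fun h => by cases a; cases b; simp_all, fun h => by subst h; simp⟩

/-- The wall of orientation `o` of the current cell towards which the particle is heading. -/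
def Pose.face (p : Pose) : Orientation → Wall
  | .horizontal => ⟨.horizontal, p.x, if p.up then p.y + 1 else p.y⟩
  | .vertical => ⟨.vertical, if p.right then p.x + 1 else p.x, p.y⟩

/-- The pose after passing through an erased wall of orientation `o`. -/
def Pose.cross (p : Pose) : Orientation → Pose
  | .horizontal => ⟨p.x, if p.up then p.y + 1 else p.y - 1, p.right, p.up⟩
  | .vertical => ⟨if p.right then p.x + 1 else p.x - 1, p.y, p.right, p.up⟩

/-- The pose after reflecting off a solid wall of orientation `o`. -/
def Pose.bounce (p : Pose) : Orientation → Pose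
  | .horizontal => ⟨p.x, p.y, p.right, !p.up⟩
  | .vertical => ⟨p.x, p.y, !p.right, p.up⟩

open Classical in
/-- One encounter of the cell automaton with a wall of orientation `o`. The second component of
the state is the set of solid walls. -/
noncomputable def advance (c : Pose × Set Wall) (o : Orientation) : Pose × Set Wall :=
  if c.1.face o ∈ c.2 then (c.1.bounce o, c.2 \ {c.1.face o}) else (c.1.cross o, c.2)

theorem advance_of_mem {p : Pose} {S : Set Wall} {o : Orientation} (h : p.face o ∈ S) :
    advance (p, S) o = (p.bounce o, S \ {p.face o}) := if_pos h

theorem advance_of_notMem {p : Pose} {S : Set Wall} {o : Orientation} (h : p.face o ∉ S) :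
    advance (p, S) o = (p.cross o, S) := if_neg h

/-- The cell automaton run on a word of wall orientations. -/
noncomputable def advanceWord (c : Pose × Set Wall) (w : List Orientation) : Pose × Set Wall :=
  w.foldl advance c

@[simp] theorem advanceWord_nil (c : Pose × Set Wall) : advanceWord c [] = c := rfl

@[simp] theorem advanceWord_cons (c : Pose × Set Wall) (o : Orientation) (w : List Orientation) :
    advanceWord c (o :: w) = advanceWord (advance c o) w := rfl

/-- The cell automaton run with partial knowledge `K` of the solid walls: `K w` is `some true` for
a wall known to be solid, `some false` for a wall known to be erased and `none` otherwise. The list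
`E` collects the walls erased so far. The result is `none` as soon as the knowledge does not
suffice. -/
def simulate (K : Wall → Option Bool) :
    List Orientation → Pose → List Wall → Option (Pose × List Wall)
  | [], p, E => some (p, E)
  | o :: w, p, E =>
    if p.face o ∈ E then simulate K w (p.cross o) E
    else match K (p.face o) with
      | none => none
      | some true => simulate K w (p.bounce o) (p.face o :: E)
      | some false => simulate K w (p.cross o) E

/-- A placement of combinatorial data in the plane: translation by `(x, y)` followed by an optional
reversal of each of the axes, the reversal being the one that fixes the cell `(0, 0)`. -/
structure Frame : Type where
  flipX : Bool
  flipY : Bool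
  x : ℤ
  y : ℤ

/-- The frame that is obtained by preceding `g` with the translation by `d`. -/
def Frame.shift (g : Frame) (d : ℤ × ℤ) : Frame := ⟨g.flipX, g.flipY, g.x + d.1, g.y + d.2⟩

/-- Reversal of an integer coordinate of cells. -/
def flipCell (b : Bool) (a : ℤ) : ℤ := if b then -a else a

/-- Reversal of an integer coordinate of grid lines: the lines that bound the cell column `0` are
`0` and `1`, and the reversal exchanges them. -/
def flipLine (b : Bool) (a : ℤ) : ℤ := if b then 1 - a else a

/-- The image of a wall under a frame. -/
def Frame.wall (g : Frame) (w : Wall) : Wall :=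
  match w.orientation with
  | .horizontal => ⟨.horizontal, flipCell g.flipX (w.x + g.x), flipLine g.flipY (w.y + g.y)⟩
  | .vertical => ⟨.vertical, flipLine g.flipX (w.x + g.x), flipCell g.flipY (w.y + g.y)⟩

/-- The image of a pose under a frame. -/
def Frame.pose (g : Frame) (p : Pose) : Pose :=
  ⟨flipCell g.flipX (p.x + g.x), flipCell g.flipY (p.y + g.y), g.flipX ^^ p.right,
    g.flipY ^^ p.up⟩

/-- The translate of a wall. -/
def Wall.translate (w : Wall) (d : ℤ × ℤ) : Wall := ⟨w.orientation, w.x + d.1, w.y + d.2⟩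

/-- The translate of a pose. -/
def Pose.translate (p : Pose) (d : ℤ × ℤ) : Pose := ⟨p.x + d.1, p.y + d.2, p.right, p.up⟩

theorem Frame.wall_shift (g : Frame) (d : ℤ × ℤ) (w : Wall) :
    (g.shift d).wall w = g.wall (w.translate d) := by
  rcases w with ⟨o, a, b⟩
  cases o <;> simp [Frame.wall, Frame.shift, Wall.translate, add_comm, add_left_comm]

theorem Frame.pose_shift (g : Frame) (d : ℤ × ℤ) (p : Pose) :
    (g.shift d).pose p = g.pose (p.translate d) := by
  simp [Frame.pose, Frame.shift, Pose.translate, add_comm, add_left_comm]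

theorem Frame.wall_injective (g : Frame) : Function.Injective g.wall := by
  rintro ⟨o, a, b⟩ ⟨o', a', b'⟩ h
  rcases g with ⟨fx, fy, u, v⟩
  cases o <;> cases o' <;> cases fx <;> cases fy <;>
    simp [Frame.wall, flipCell, flipLine] at h ⊢ <;> omega

theorem Frame.face_pose (g : Frame) (p : Pose) (o : Orientation) :
    (g.pose p).face o = g.wall (p.face o) := by
  rcases g with ⟨fx, fy, u, v⟩
  rcases p with ⟨a, b, r, t⟩
  cases o <;> cases fx <;> cases fy <;> cases r <;> cases t <;>
    simp [Frame.pose, Pose.face, Frame.wall, flipCell, flipLine] <;> omega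

theorem Frame.cross_pose (g : Frame) (p : Pose) (o : Orientation) :
    (g.pose p).cross o = g.pose (p.cross o) := by
  rcases g with ⟨fx, fy, u, v⟩
  rcases p with ⟨a, b, r, t⟩
  cases o <;> cases fx <;> cases fy <;> cases r <;> cases t <;>
    simp [Frame.pose, Pose.cross, flipCell] <;> omega

theorem Frame.bounce_pose (g : Frame) (p : Pose) (o : Orientation) :
    (g.pose p).bounce o = g.pose (p.bounce o) := by
  rcases g with ⟨fx, fy, u, v⟩
  rcases p with ⟨a, b, r, t⟩
  cases o <;> cases fx <;> cases fy <;> cases r <;> cases t <;> rfl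

/-- The set `S` of solid walls agrees with the knowledge `K`, placed in the plane by `g`. -/
def Frame.Knows (g : Frame) (K : Wall → Option Bool) (S : Set Wall) : Prop :=
  ∀ w b, K w = some b → (g.wall w ∈ S ↔ b = true)

/-- A successful simulation predicts the cell automaton for every set of solid walls that agrees
with the knowledge, wherever and in whichever orientation it is placed. -/
theorem advanceWord_of_simulate {g : Frame} {K : Wall → Option Bool} {S : Set Wall}
    (hK : g.Knows K S) {w : List Orientation} {p p' : Pose} {E E' : List Wall}
    (h : simulate K w p E = some (p', E')) :
    advanceWord (g.pose p, S \ g.wall '' {u | u ∈ E}) w =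
      (g.pose p', S \ g.wall '' {u | u ∈ E'}) := by
  induction w generalizing p E with
  | nil =>
    simp only [simulate, Option.some.injEq, Prod.mk.injEq] at h
    simp [h.1, h.2]
  | cons o w ih =>
    have mem : g.wall (p.face o) ∈ g.wall '' {u | u ∈ E} ↔ p.face o ∈ E :=
      g.wall_injective.mem_set_image
    rw [simulate] at h
    rw [advanceWord_cons]
    split_ifs at h with hE
    · rw [advance_of_notMem (by rw [g.face_pose]; exact fun hh => hh.2 (mem.2 hE)), g.cross_pose]
      exact ih h
    · split at h
      · cases h
      · rename_i hk
        rw [advance_of_mem (by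
          rw [g.face_pose]; exact ⟨(hK _ _ hk).2 rfl, fun hh => hE (mem.1 hh)⟩), g.bounce_pose,
          g.face_pose, ← ih h]
        congr 2
        ext v
        simp only [Set.mem_sdiff, mem_singleton_iff, mem_image, mem_ofPred_eq, List.mem_cons]
        grind
      · rename_i hk
        rw [advance_of_notMem (by
          rw [g.face_pose]; exact fun hh => by simpa using (hK _ _ hk).1 hh.1), g.cross_pose]
        exact ih h

theorem simulate_append {K : Wall → Option Bool} {w₁ w₂ : List Orientation} {p : Pose}
    {E : List Wall} :
    simulate K (w₁ ++ w₂) p E = (simulate K w₁ p E).bind fun q => simulate K w₂ q.1 q.2 := by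
  induction w₁ generalizing p E with
  | nil => rfl
  | cons o w ih =>
    simp only [List.cons_append, simulate]
    split_ifs
    · exact ih
    · split <;> simp_all

/-! ### Unfolding the trajectory -/

/-- The state `st`, whose speed is `(±1, ±s)`, is described by the cell automaton state `c` and by
the distances `ξ` and `η` that the particle has covered horizontally and vertically since it last
met a vertical, respectively horizontal, grid line. These distances ignore whether the particle was
reflected or passed, so they evolve as in the unfolded, straight trajectory. -/
structure Tracks (st : State) (s : ℝ) (c : Pose × Set Wall) (ξ η : ℝ) : Prop where
  solid : st.solid = c.2
  vel_zero : st.vel 0 = if c.1.right then 1 else -1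
  vel_one : st.vel 1 = if c.1.up then s else -s
  pos_zero : st.pos 0 = if c.1.right then c.1.x + ξ else c.1.x + 1 - ξ
  pos_one : st.pos 1 = if c.1.up then c.1.y + η else c.1.y + 1 - η
  xi_nonneg : 0 ≤ ξ
  xi_lt : ξ < 1
  eta_nonneg : 0 ≤ η
  eta_lt : η < 1
  pos_or : 0 < ξ ∨ 0 < η

theorem isInt_intCast_add {n : ℤ} {a : ℝ} : IsInt (n + a) ↔ IsInt a := by
  constructor
  · rintro ⟨m, hm⟩
    exact ⟨m - n, by push_cast; linarith⟩
  · rintro ⟨m, hm⟩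
    exact ⟨n + m, by push_cast; linarith⟩

theorem isInt_intCast_sub {n : ℤ} {a : ℝ} : IsInt (n - a) ↔ IsInt a := by
  constructor
  · rintro ⟨m, hm⟩
    exact ⟨n - m, by push_cast; linarith⟩
  · rintro ⟨m, hm⟩
    exact ⟨n - m, by push_cast; linarith⟩

theorem not_isInt_of_mem_Ioo {a : ℝ} (h0 : 0 < a) (h1 : a < 1) : ¬ IsInt a := by
  rintro ⟨n, rfl⟩
  have h2 : (0 : ℤ) < n := by exact_mod_cast h0
  have h3 : n < (1 : ℤ) := by exact_mod_cast h1
  omega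

theorem floor_intCast_add_of_mem_Ioo {n : ℤ} {a : ℝ} (h0 : 0 < a) (h1 : a < 1) :
    ⌊(n : ℝ) + a⌋ = n := by
  rw [Int.floor_eq_iff]
  constructor <;> linarith

namespace Tracks

variable {st : State} {s : ℝ} {c : Pose × Set Wall} {ξ η : ℝ}

theorem isInt_zero (h : Tracks st s c ξ η) (t : ℝ) :
    IsInt (st.pos 0 + t * st.vel 0) ↔ IsInt (ξ + t) := by
  rw [h.pos_zero, h.vel_zero]
  split_ifs
  · rw [show (c.1.x : ℝ) + ξ + t * 1 = c.1.x + (ξ + t) by ring, isInt_intCast_add]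
  · rw [show (c.1.x : ℝ) + 1 - ξ + t * -1 = ((c.1.x + 1 : ℤ) : ℝ) - (ξ + t) by push_cast; ring,
      isInt_intCast_sub]

theorem isInt_one (h : Tracks st s c ξ η) (t : ℝ) :
    IsInt (st.pos 1 + t * st.vel 1) ↔ IsInt (η + t * s) := by
  rw [h.pos_one, h.vel_one]
  split_ifs
  · rw [show (c.1.y : ℝ) + η + t * s = c.1.y + (η + t * s) by ring, isInt_intCast_add]
  · rw [show (c.1.y : ℝ) + 1 - η + t * -s = ((c.1.y + 1 : ℤ) : ℝ) - (η + t * s) by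
      push_cast; ring, isInt_intCast_sub]

theorem not_isCorner (h : Tracks st s c ξ η) : ¬ IsCorner st.pos := by
  rintro ⟨h0, h1⟩
  have h0' := (h.isInt_zero 0).1 (by simpa using h0)
  have h1' := (h.isInt_one 0).1 (by simpa using h1)
  rw [add_zero] at h0'
  rw [zero_mul, add_zero] at h1'
  rcases h.pos_or with h2 | h2
  · exact not_isInt_of_mem_Ioo h2 h.xi_lt h0'
  · exact not_isInt_of_mem_Ioo h2 h.eta_lt h1'

theorem encounterTime (h : Tracks st s c ξ η) (hs : 0 < s) :
    st.encounterTime = min (1 - ξ) ((1 - η) / s) := by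
  have hξ := h.xi_lt
  have hη : 0 < (1 - η) / s := div_pos (by linarith [h.eta_lt]) hs
  apply IsLeast.csInf_eq
  constructor
  · refine ⟨lt_min (by linarith) hη, ?_⟩
    rw [h.isInt_zero, h.isInt_one]
    rcases min_choice (1 - ξ) ((1 - η) / s) with h1 | h1 <;> rw [h1]
    · exact Or.inl ⟨1, by push_cast; ring⟩
    · exact Or.inr ⟨1, by rw [div_mul_cancel₀ _ hs.ne']; push_cast; ring⟩
  · rintro t ⟨ht, h1 | h1⟩
    · rw [h.isInt_zero] at h1
      apply min_le_of_left_le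
      by_contra! h2
      exact not_isInt_of_mem_Ioo (by linarith [h.xi_nonneg]) (by linarith) h1
    · rw [h.isInt_one] at h1
      apply min_le_of_right_le
      by_contra! h2
      rw [lt_div_iff₀ hs] at h2
      exact not_isInt_of_mem_Ioo (by nlinarith [h.eta_nonneg]) (by linarith) h1

theorem encounterPoint_apply (st : State) (i : Fin 2) :
    st.encounterPoint i = st.pos i + st.encounterTime * st.vel i := by
  simp [State.encounterPoint]

/-- If the line through the particle leaves the current cell through a vertical side, then the next
encounter follows the cell automaton reading a vertical wall. -/
theorem vertical (h : Tracks st s c ξ η) (hs : 0 < s) (hlt : s * (1 - ξ) + η < 1) :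
    (st.Collides ↔ c.1.face .vertical ∈ c.2) ∧
      wallAt st.encounterPoint = c.1.face .vertical ∧
      Tracks st.step s (advance c .vertical) 0 (s * (1 - ξ) + η) := by
  obtain ⟨p, S⟩ := c
  obtain ⟨x, y, r, u⟩ := p
  have hξ := h.xi_lt
  have hη := h.eta_nonneg
  have hpos : 0 < s * (1 - ξ) := mul_pos hs (by linarith)
  have ht : st.encounterTime = 1 - ξ := by
    rw [h.encounterTime hs, min_eq_left]
    rw [le_div_iff₀ hs]
    linarith
  have e0 : st.encounterPoint 0 = if r then (x : ℝ) + 1 else x := by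
    rw [encounterPoint_apply, ht, h.pos_zero, h.vel_zero]
    cases r <;> simp
  have e1 : st.encounterPoint 1 =
      if u then y + (s * (1 - ξ) + η) else y + (1 - (s * (1 - ξ) + η)) := by
    rw [encounterPoint_apply, ht, h.pos_one, h.vel_one]
    cases u <;> simp <;> ring
  have i0 : IsInt (st.encounterPoint 0) := by
    rw [e0]
    cases r
    · exact ⟨x, by simp⟩
    · exact ⟨x + 1, by simp⟩
  have i1 : ¬ IsInt (st.encounterPoint 1) := by
    rw [e1]
    split_ifs <;> rw [isInt_intCast_add] <;> apply not_isInt_of_mem_Ioo <;> linarith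
  have f0 : ⌊st.encounterPoint 0⌋ = if r then x + 1 else x := by
    rw [e0]
    cases r
    · simp
    · simp
  have f1 : ⌊st.encounterPoint 1⌋ = y := by
    rw [e1]
    split_ifs <;> apply floor_intCast_add_of_mem_Ioo <;> linarith
  have hw : wallAt st.encounterPoint = Pose.face ⟨x, y, r, u⟩ .vertical := by
    rw [wallAt, if_pos i0, f0, f1]
    rfl
  have hc : st.Collides ↔ Pose.face ⟨x, y, r, u⟩ .vertical ∈ S := by
    rw [State.Collides, hw, h.solid]
    exact ⟨fun hh => hh.2.2, fun hh => ⟨h.not_isCorner, fun hh => i1 hh.2, hh⟩⟩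
  refine ⟨hc, hw, ?_⟩
  rw [State.step, if_neg h.not_isCorner]
  have v0 := h.vel_zero
  have v1 := h.vel_one
  by_cases hm : Pose.face ⟨x, y, r, u⟩ .vertical ∈ S
  · rw [if_pos (hc.2 hm), advance_of_mem hm, hw]
    refine ⟨by simp [h.solid], ?_, ?_, ?_, ?_, le_rfl, one_pos, by linarith, hlt,
      Or.inr (by linarith)⟩
    · cases r <;> simpa [reflect, Pose.face, Pose.bounce, neg_eq_iff_eq_neg] using v0
    · cases u <;> simpa [reflect, Pose.face, Pose.bounce] using v1
    · cases r <;> simpa [Pose.bounce] using e0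
    · cases u <;> simp [Pose.bounce] at e1 ⊢ <;> linarith
  · rw [if_neg (fun hh => hm (hc.1 hh)), advance_of_notMem hm]
    refine ⟨h.solid, v0, v1, ?_, ?_, le_rfl, one_pos, by linarith, hlt, Or.inr (by linarith)⟩
    · cases r <;> simpa [Pose.cross] using e0
    · cases u <;> simp [Pose.cross] at e1 ⊢ <;> linarith

/-- If the line through the particle leaves the current cell through a horizontal side, then the
next encounter follows the cell automaton reading a horizontal wall. -/
theorem horizontal (h : Tracks st s c ξ η) (hs : 0 < s) (hlt : 1 < s * (1 - ξ) + η) :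
    (st.Collides ↔ c.1.face .horizontal ∈ c.2) ∧
      wallAt st.encounterPoint = c.1.face .horizontal ∧
      Tracks st.step s (advance c .horizontal) (ξ + (1 - η) / s) 0 := by
  obtain ⟨p, S⟩ := c
  obtain ⟨x, y, r, u⟩ := p
  have hξ := h.xi_nonneg
  have hη := h.eta_lt
  have hpos : 0 < (1 - η) / s := div_pos (by linarith) hs
  have hlt' : (1 - η) / s < 1 - ξ := by
    rw [div_lt_iff₀ hs]
    linarith
  have ht : st.encounterTime = (1 - η) / s := by
    rw [h.encounterTime hs, min_eq_right hlt'.le]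
  have hts : (1 - η) / s * s = 1 - η := div_mul_cancel₀ _ hs.ne'
  have e1 : st.encounterPoint 1 = if u then (y : ℝ) + 1 else y := by
    rw [encounterPoint_apply, ht, h.pos_one, h.vel_one]
    cases u <;> simp [hts]
  have e0 : st.encounterPoint 0 =
      if r then x + (ξ + (1 - η) / s) else x + (1 - (ξ + (1 - η) / s)) := by
    rw [encounterPoint_apply, ht, h.pos_zero, h.vel_zero]
    cases r <;> simp <;> ring
  have i0 : ¬ IsInt (st.encounterPoint 0) := by
    rw [e0]
    split_ifs <;> rw [isInt_intCast_add] <;> apply not_isInt_of_mem_Ioo <;> linarith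
  have i1 : IsInt (st.encounterPoint 1) := by
    rw [e1]
    cases u
    · exact ⟨y, by simp⟩
    · exact ⟨y + 1, by simp⟩
  have f0 : ⌊st.encounterPoint 0⌋ = x := by
    rw [e0]
    split_ifs <;> apply floor_intCast_add_of_mem_Ioo <;> linarith
  have f1 : ⌊st.encounterPoint 1⌋ = if u then y + 1 else y := by
    rw [e1]
    cases u <;> simp
  have hw : wallAt st.encounterPoint = Pose.face ⟨x, y, r, u⟩ .horizontal := by
    rw [wallAt, if_neg i0, f0, f1]
    rfl
  have hc : st.Collides ↔ Pose.face ⟨x, y, r, u⟩ .horizontal ∈ S := by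
    rw [State.Collides, hw, h.solid]
    exact ⟨fun hh => hh.2.2, fun hh => ⟨h.not_isCorner, fun hh => i0 hh.1, hh⟩⟩
  refine ⟨hc, hw, ?_⟩
  rw [State.step, if_neg h.not_isCorner]
  have v0 := h.vel_zero
  have v1 := h.vel_one
  by_cases hm : Pose.face ⟨x, y, r, u⟩ .horizontal ∈ S
  · rw [if_pos (hc.2 hm), advance_of_mem hm, hw]
    refine ⟨by simp [h.solid], ?_, ?_, ?_, ?_, by linarith, by linarith, le_rfl, one_pos,
      Or.inl (by linarith)⟩
    · cases r <;> simpa [reflect, Pose.face, Pose.bounce] using v0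
    · cases u <;> simpa [reflect, Pose.face, Pose.bounce, neg_eq_iff_eq_neg] using v1
    · cases r <;> simp [Pose.bounce] at e0 ⊢ <;> linarith
    · cases u <;> simpa [Pose.bounce] using e1
  · rw [if_neg (fun hh => hm (hc.1 hh)), advance_of_notMem hm]
    refine ⟨h.solid, v0, v1, ?_, ?_, by linarith, by linarith, le_rfl, one_pos,
      Or.inl (by linarith)⟩
    · cases r <;> simp [Pose.cross] at e0 ⊢ <;> linarith
    · cases u <;> simpa [Pose.cross] using e1

/-- If the line through the particle leaves the current cell through a vertex, then the particle
stops there. -/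
theorem corner (h : Tracks st s c ξ η) (hs : 0 < s) (heq : s * (1 - ξ) + η = 1) :
    IsCorner st.step.pos := by
  have ht : st.encounterTime = 1 - ξ := by
    rw [h.encounterTime hs, min_eq_left]
    rw [le_div_iff₀ hs]
    linarith
  have hc : IsCorner st.encounterPoint := by
    constructor
    · rw [encounterPoint_apply, h.isInt_zero, ht]
      exact ⟨1, by push_cast; ring⟩
    · rw [encounterPoint_apply, h.isInt_one, ht]
      exact ⟨1, by push_cast; linarith⟩
  rw [State.step, if_neg h.not_isCorner, if_neg (fun hh => hh.2.1 hc)]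
  exact hc

end Tracks

/-- In the unfolded plane, the line of slope `s` through the point with fractional coordinates
`(ξ, η)` crosses grid lines in the order given by the word, and it then has fractional coordinates
`(ξ', η')`. -/
def Reads (s : ℝ) : List Orientation → ℝ → ℝ → ℝ → ℝ → Prop
  | [], ξ, η, ξ', η' => ξ' = ξ ∧ η' = η
  | .vertical :: w, ξ, η, ξ', η' => s * (1 - ξ) + η < 1 ∧ Reads s w 0 (s * (1 - ξ) + η) ξ' η'
  | .horizontal :: w, ξ, η, ξ', η' =>
    1 < s * (1 - ξ) + η ∧ Reads s w (ξ + (1 - η) / s) 0 ξ' η'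

theorem Reads.append {s : ℝ} {w₁ w₂ : List Orientation} {ξ η ξ' η' ξ'' η'' : ℝ}
    (h₁ : Reads s w₁ ξ η ξ' η') (h₂ : Reads s w₂ ξ' η' ξ'' η'') :
    Reads s (w₁ ++ w₂) ξ η ξ'' η'' := by
  induction w₁ generalizing ξ η with
  | nil =>
    obtain ⟨rfl, rfl⟩ := h₁
    exact h₂
  | cons o w ih => cases o <;> exact ⟨h₁.1, ih h₁.2⟩

/-- The word read between two vertical grid lines, if `q` horizontal ones are crossed. -/
def columnWord (q : ℕ) : List Orientation := List.replicate q .horizontal ++ [.vertical]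

theorem reads_columnWord {s : ℝ} (hs : 0 < s) {q : ℕ} {ξ η : ℝ} (h0 : (q : ℝ) < s * (1 - ξ) + η)
    (h1 : s * (1 - ξ) + η < q + 1) :
    Reads s (columnWord q) ξ η 0 (s * (1 - ξ) + η - q) := by
  induction q generalizing ξ η with
  | zero => exact ⟨by simpa using h1, rfl, by simp⟩
  | succ q ih =>
    have key : s * (1 - (ξ + (1 - η) / s)) + 0 = s * (1 - ξ) + η - 1 := by
      field_simp
      ring
    push_cast at h0 h1
    refine ⟨by linarith [(Nat.cast_nonneg q : (0 : ℝ) ≤ q)], ?_⟩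
    have := @ih (ξ + (1 - η) / s) 0 (by linarith) (by linarith)
    rw [key, sub_sub, add_comm (1 : ℝ), ← Nat.cast_succ] at this
    exact this

theorem Tracks.word {s : ℝ} (hs : 0 < s) {w : List Orientation} {st : State} {c : Pose × Set Wall}
    {ξ η ξ' η' : ℝ} (h : Tracks st s c ξ η) (hw : Reads s w ξ η ξ' η') :
    Tracks (State.step^[w.length] st) s (advanceWord c w) ξ' η' ∧
      ∀ (r : ℕ) (hr : r < w.length),
        ((State.step^[r] st).Collides ↔
          (advanceWord c (w.take r)).1.face w[r] ∈ (advanceWord c (w.take r)).2) ∧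
        wallAt (State.step^[r] st).encounterPoint = (advanceWord c (w.take r)).1.face w[r] := by
  induction w generalizing st c ξ η with
  | nil =>
    obtain ⟨rfl, rfl⟩ := hw
    exact ⟨h, fun r hr => absurd hr (Nat.not_lt_zero r)⟩
  | cons o w ih =>
    have step : (st.Collides ↔ c.1.face o ∈ c.2) ∧ wallAt st.encounterPoint = c.1.face o ∧
        ∃ ξ₁ η₁, Tracks st.step s (advance c o) ξ₁ η₁ ∧ Reads s w ξ₁ η₁ ξ' η' := by
      cases o
      · obtain ⟨a, b, d⟩ := h.horizontal hs hw.1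
        exact ⟨a, b, _, _, d, hw.2⟩
      · obtain ⟨a, b, d⟩ := h.vertical hs hw.1
        exact ⟨a, b, _, _, d, hw.2⟩
    obtain ⟨h1, h2, ξ₁, η₁, h3, h4⟩ := step
    obtain ⟨h5, h6⟩ := ih h3 h4
    refine ⟨h5, ?_⟩
    rintro (_ | r) hr
    · exact ⟨h1, h2⟩
    · exact h6 r (by simpa using hr)

/-- If the unfolded trajectory passes through a lattice point, then the particle hits a corner. -/
theorem Tracks.exists_isCorner {s : ℝ} (hs : 0 < s) {N : ℕ} {st : State} {c : Pose × Set Wall}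
    {ξ η : ℝ} (h : Tracks st s c ξ η) (heq : s * (1 - ξ) + η = N + 1) :
    ∃ n, IsCorner (State.step^[n] st).pos := by
  induction N generalizing st c ξ η with
  | zero => exact ⟨1, h.corner hs (by simpa using heq)⟩
  | succ N ih =>
    push_cast at heq
    have hN : (0 : ℝ) ≤ N := N.cast_nonneg
    have key : s * (1 - (ξ + (1 - η) / s)) + 0 = s * (1 - ξ) + η - 1 := by
      field_simp
      ring
    obtain ⟨n, hn⟩ := ih (h.horizontal hs (by linarith)).2.2 (by rw [key]; linarith)
    exact ⟨n + 1, hn⟩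

theorem tracks_start {P : Plane} (hP : ∀ i, P i ∈ Ioo (0 : ℝ) 1) (s : ℝ) :
    Tracks (start P s) s (⟨0, 0, true, true⟩, univ) (P 0) (P 1) where
  solid := rfl
  vel_zero := by simp [start]
  vel_one := by simp [start]
  pos_zero := by simp [start]
  pos_one := by simp [start]
  xi_nonneg := (hP 0).1.le
  xi_lt := (hP 0).2
  eta_nonneg := (hP 1).1.le
  eta_lt := (hP 1).2
  pos_or := Or.inl (hP 0).1

/-- If the line of slope `s` through `P` has an integer height over no integer abscissa, then the
particle hits no corner. -/
theorem not_hitsCorner {P : Plane} (hP : ∀ i, P i ∈ Ioo (0 : ℝ) 1) {s : ℝ} (hs : 0 < s)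
    (h : ∀ m k : ℤ, P 1 + s * (m - P 0) ≠ k) : ¬ HitsCorner P s := by
  have main : ∀ n, ∃ c ξ η, Tracks (orbit P s n) s c ξ η ∧
      ∃ m k : ℤ, s * (1 - ξ) + η = P 1 + s * (m - P 0) + k := by
    intro n
    induction n with
    | zero => exact ⟨_, _, _, tracks_start hP s, 1, 0, by push_cast; ring⟩
    | succ n ih =>
      obtain ⟨c, ξ, η, ht, m, k, hmk⟩ := ih
      rw [orbit, Function.iterate_succ_apply']
      rcases lt_trichotomy (s * (1 - ξ) + η) 1 with h1 | h1 | h1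
      · refine ⟨_, _, _, (ht.vertical hs h1).2.2, m + 1, k, ?_⟩
        push_cast
        linarith
      · exact absurd (show P 1 + s * (m - P 0) = ((1 - k : ℤ) : ℝ) by push_cast; linarith) (h _ _)
      · refine ⟨_, _, _, (ht.horizontal hs h1).2.2, m, k - 1, ?_⟩
        push_cast
        have : s * (1 - (ξ + (1 - η) / s)) + 0 = s * (1 - ξ) + η - 1 := by
          field_simp
          ring
        linarith
  rintro ⟨n, hn⟩
  obtain ⟨c, ξ, η, ht, -⟩ := main n
  exact ht.not_isCorner hn

theorem countable_hitsCorner {P : Plane} (hP : ∀ i, P i ∈ Ioo (0 : ℝ) 1) :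
    {s : ℝ | 0 < s ∧ HitsCorner P s}.Countable := by
  refine (countable_range fun q : ℤ × ℤ => (q.2 - P 1) / (q.1 - P 0)).mono ?_
  rintro s ⟨hs, hc⟩
  by_contra hne
  refine not_hitsCorner hP hs (fun m k hmk => hne ⟨(m, k), ?_⟩) hc
  have hm : (m : ℝ) - P 0 ≠ 0 := by
    intro h0
    exact not_isInt_of_mem_Ioo (hP 0).1 (hP 0).2 ⟨m, by linarith⟩
  rw [div_eq_iff hm]
  linarith

/-! ### The blocks of the tunnel -/

/-- The pose at the beginning of a block. -/
def basePose : Pose := ⟨0, 0, true, true⟩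

/-- The solid walls behind the front of the tunnel whose presence matters for the digging: those that
the particle meets in the next block, and those that become such walls after further blocks. -/
def solidBehind : List Wall :=
  [⟨.horizontal, -1, -3⟩, ⟨.horizontal, 0, -2⟩, ⟨.horizontal, 0, -1⟩, ⟨.horizontal, 0, 0⟩,
    ⟨.vertical, -1, -3⟩, ⟨.vertical, 0, -2⟩, ⟨.vertical, 0, -1⟩]

/-- The erased walls behind the front of the tunnel whose absence matters for the digging. -/
def erasedBehind : List Wall :=
  [⟨.horizontal, -1, -2⟩, ⟨.horizontal, -1, -1⟩, ⟨.horizontal, -1, 0⟩, ⟨.vertical, 0, 0⟩]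

/-- The knowledge of the walls at the beginning of a block: everything ahead of the front
`2 x + y = 1` is solid, and the status of a few walls behind the front is known. -/
def baseKnowledge (w : Wall) : Option Bool :=
  if 1 ≤ 2 * w.x + w.y then some true
  else if w ∈ solidBehind then some true
  else if w ∈ erasedBehind then some false
  else none

/-- Whether `baseKnowledge`, translated by `d`, holds once `baseKnowledge` held and the walls in `E`
have been erased. For the walls ahead of the front it is enough that the front stays ahead of `E`. -/
def Renews (K : Wall → Option Bool) (E : List Wall) (d : ℤ × ℤ) : Prop :=
  (∀ w ∈ E, 2 * w.x + w.y < 1 + 2 * d.1 + d.2) ∧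
  (∀ w ∈ solidBehind, w.translate d ∉ E ∧ K (w.translate d) = some true) ∧
  ∀ w ∈ erasedBehind, w.translate d ∈ E ∨ K (w.translate d) = some false

instance (K : Wall → Option Bool) (E : List Wall) (d : ℤ × ℤ) : Decidable (Renews K E d) := by
  unfold Renews
  infer_instance

theorem Renews.knows {K : Wall → Option Bool} {E : List Wall} {d : ℤ × ℤ} (h : Renews K E d)
    (hK : ∀ w : Wall, 1 + 2 * d.1 + d.2 ≤ 2 * w.x + w.y → K w = some true)
    {g : Frame} {S : Set Wall} (hS : g.Knows K S) :
    (g.shift d).Knows baseKnowledge (S \ g.wall '' {u | u ∈ E}) := by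
  intro w b hb
  rw [g.wall_shift, Set.mem_sdiff, g.wall_injective.mem_set_image]
  have tx : (w.translate d).x = w.x + d.1 := rfl
  have ty : (w.translate d).y = w.y + d.2 := rfl
  obtain ⟨h1, h2, h3⟩ := h
  unfold baseKnowledge at hb
  split_ifs at hb with c1 c2 c3
  · obtain rfl : true = b := by simpa using hb
    have hE : w.translate d ∉ E := fun hh => by
      have := h1 _ hh
      rw [tx, ty] at this
      omega
    have := (hS _ _ (hK (w.translate d) (by rw [tx, ty]; omega))).2 rfl
    simp [this, hE]
  · obtain rfl : true = b := by simpa using hb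
    have := (hS _ _ (h2 w c2).2).2 rfl
    simp [this, (h2 w c2).1]
  · obtain rfl : false = b := by simpa using hb
    rcases h3 w c3 with h4 | h4
    · simp [h4]
    · have := hS _ _ h4
      simp_all

/-- The kind of a block: `none` for the short block, of three columns with three horizontal
crossings each, and `some i` for the long block, of 17 columns, in which column number `i` has four
horizontal crossings. A long block resumes the pattern of the short ones after 14 columns; three more
columns take it far enough away from its irregularly erased walls for another long block. -/
abbrev Kind : Type := Option (Fin 3)

/-- The numbers of horizontal crossings in the columns of a block. -/
def Kind.columns : Kind → List ℕ
  | none => [3, 3, 3]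
  | some i => List.replicate i 3 ++ 4 :: List.replicate (16 - i) 3

/-- The word that is read during a block. -/
def Kind.word (k : Kind) : List Orientation := k.columns.flatMap columnWord

/-- The displacement of the front of the tunnel by a block. -/
def Kind.disp : Kind → ℤ × ℤ
  | none => (1, 1)
  | some _ => (3, 4)

/-- The walls that are erased during a block. -/
def Kind.erased (k : Kind) : List Wall :=
  ((simulate baseKnowledge k.word basePose []).map Prod.snd).getD []

theorem Kind.simulate_eq (k : Kind) :
    simulate baseKnowledge k.word basePose [] = some (basePose.translate k.disp, k.erased) := by
  revert k
  decide +kernel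

theorem Kind.renews (k : Kind) : Renews baseKnowledge k.erased k.disp := by
  revert k
  decide +kernel

theorem Kind.abs_erased_le (k : Kind) : ∀ w ∈ k.erased, |w.x| ≤ 7 ∧ |w.y| ≤ 7 := by
  revert k
  decide +kernel

theorem Kind.head_word (k : Kind) : k.word.head? = some .horizontal := by
  revert k
  decide +kernel

/-- The reversal of the axes that makes the tunnel run up and to the right, for a trajectory that
crosses `j` horizontal grid lines before the first vertical one. -/
def initialFrame (j : Fin 4) : Frame := ⟨j == 0, j == 1, 0, 0⟩

/-- The number of columns after which the first block begins. -/
def initialColumns (j : Fin 4) : ℕ := ![3, 7, 5, 2] j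

/-- The word that is read before the first block begins. -/
def initialWord (j : Fin 4) : List Orientation :=
  columnWord j ++ (List.replicate (initialColumns j) 3).flatMap columnWord

/-- The displacement of the base cell before the first block begins. -/
def initialDisp (j : Fin 4) : ℤ × ℤ := ![(1, 1), (2, 1), (2, 1), (1, 1)] j

/-- The walls that are erased before the first block begins. -/
def initialErased (j : Fin 4) : List Wall :=
  ((simulate (fun _ => some true) (initialWord j) ((initialFrame j).pose basePose) []).map
    Prod.snd).getD []

theorem simulate_initial (j : Fin 4) :
    simulate (fun _ => some true) (initialWord j) ((initialFrame j).pose basePose) [] =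
      some (basePose.translate (initialDisp j), initialErased j) := by
  revert j
  decide +kernel

theorem renews_initial (j : Fin 4) :
    Renews (fun _ => some true) (initialErased j) (initialDisp j) := by
  revert j
  decide +kernel

/-! ### Steady digging -/

/-- After `n` encounters the particle has just met a vertical wall, at height `h` above the previous
horizontal grid line of the unfolded plane, and a block of the tunnel begins, placed by `g`. -/
def Cruise (P : Plane) (s : ℝ) (g : Frame) (n : ℕ) (h : ℝ) : Prop :=
  ∃ S, Tracks (orbit P s n) s (g.pose basePose, S) 0 h ∧ g.Knows baseKnowledge S

theorem orbit_add (P : Plane) (s : ℝ) (n r : ℕ) :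
    orbit P s (n + r) = State.step^[r] (orbit P s n) := by
  rw [orbit, orbit, add_comm, Function.iterate_add_apply]

theorem simulate_subset {K : Wall → Option Bool} {w : List Orientation} {p p' : Pose}
    {E E' : List Wall} (h : simulate K w p E = some (p', E')) : E ⊆ E' := by
  induction w generalizing p E with
  | nil =>
    simp only [simulate, Option.some.injEq, Prod.mk.injEq] at h
    simp [h.2]
  | cons o w ih =>
    rw [simulate] at h
    split_ifs at h
    · exact ih h
    · split at h
      · cases h
      · exact fun x hx => ih h (List.mem_cons_of_mem _ hx)
      · exact ih h

/-- The collisions during a block do not depend on where the block takes place. -/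
theorem Kind.predict (k : Kind) (r : ℕ) (hr : r < k.word.length) :
    ∃ (b : Prop) (u : Wall), (b → u ∈ k.erased) ∧ ∀ (g : Frame) (S : Set Wall),
      g.Knows baseKnowledge S →
        ((advanceWord (g.pose basePose, S) (k.word.take r)).1.face k.word[r] ∈
            (advanceWord (g.pose basePose, S) (k.word.take r)).2 ↔ b) ∧
          (advanceWord (g.pose basePose, S) (k.word.take r)).1.face k.word[r] = g.wall u := by
  have hsplit : k.word = k.word.take r ++ k.word[r] :: k.word.drop (r + 1) := by simp
  have hsim := k.simulate_eq
  rw [hsplit, simulate_append, Option.bind_eq_some_iff] at hsim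
  obtain ⟨⟨p, E⟩, hp, hq⟩ := hsim
  refine ⟨p.face k.word[r] ∉ E ∧ baseKnowledge (p.face k.word[r]) = some true, p.face k.word[r],
    ?_, ?_⟩
  · rintro ⟨h1, h2⟩
    simp only [simulate, h1, if_false, h2] at hq
    exact simulate_subset hq List.mem_cons_self
  · intro g S hS
    have := advanceWord_of_simulate hS hp
    rw [show S \ g.wall '' {u | u ∈ ([] : List Wall)} = S by simp] at this
    rw [this]
    refine ⟨?_, g.face_pose _ _⟩
    simp only [g.face_pose, Set.mem_sdiff, g.wall_injective.mem_set_image]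
    simp only [simulate] at hq
    constructor
    · rintro ⟨h1, h2⟩
      refine ⟨h2, ?_⟩
      replace h2 : p.face k.word[r] ∉ E := h2
      rw [if_neg h2] at hq
      split at hq
      · cases hq
      · assumption
      · rename_i hk
        have := (hS _ _ hk).1 h1
        simp at this
    · rintro ⟨h1, h2⟩
      exact ⟨(hS _ _ h2).2 rfl, h1⟩

/-- The kind of the block that begins at height `h`, when the slope is `3 + e`: a column has four
horizontal crossings precisely when the height would pass `1` in it. -/
noncomputable def kindAt (e h : ℝ) : Kind :=
  if h + 3 * e < 1 then none
  else if h + 2 * e < 1 then some 2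
  else if h + e < 1 then some 1
  else some 0

/-- The height at the end of a block that begins at height `h`. -/
def Kind.next (e h : ℝ) : Kind → ℝ
  | none => h + 3 * e
  | some _ => h + 17 * e - 1

theorem reads_replicate_three {s h : ℝ} (hs : 3 ≤ s) (h0 : 0 < h) (m : ℕ)
    (h1 : h + m * (s - 3) < 1) :
    Reads s ((List.replicate m 3).flatMap columnWord) 0 h 0 (h + m * (s - 3)) := by
  induction m generalizing h with
  | zero => exact ⟨rfl, by simp⟩
  | succ m ih =>
    push_cast at h1
    have hm : 0 ≤ m * (s - 3) := mul_nonneg m.cast_nonneg (by linarith)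
    have r1 := reads_columnWord (s := s) (q := 3) (ξ := 0) (η := h) (by linarith)
      (by push_cast; linarith) (by push_cast; linarith)
    push_cast at r1
    have r2 := ih (h := s * (1 - 0) + h - 3) (by linarith) (by linarith)
    have := r1.append r2
    rw [List.replicate_succ, List.flatMap_cons]
    convert this using 1
    push_cast
    ring

theorem Tracks.hitsCorner {P : Plane} {s : ℝ} (hs : 0 < s) {n N : ℕ} {c : Pose × Set Wall}
    {ξ η : ℝ} (h : Tracks (orbit P s n) s c ξ η) (heq : s * (1 - ξ) + η = N + 1) :
    HitsCorner P s := by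
  obtain ⟨r, hr⟩ := h.exists_isCorner hs heq
  exact ⟨n + r, by rwa [orbit_add]⟩

theorem Tracks.word_orbit {P : Plane} {s : ℝ} (hs : 0 < s) {n : ℕ} {w : List Orientation}
    {c : Pose × Set Wall} {ξ η ξ' η' : ℝ} (h : Tracks (orbit P s n) s c ξ η)
    (hw : Reads s w ξ η ξ' η') : Tracks (orbit P s (n + w.length)) s (advanceWord c w) ξ' η' := by
  rw [orbit_add]
  exact (h.word hs hw).1

/-- The height never is `1` at a vertical grid line, since that would be a corner. -/
theorem Tracks.height_ne_one {P : Plane} {s : ℝ} (hs : 3 ≤ s) (hc : ¬ HitsCorner P s) {n : ℕ}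
    {c : Pose × Set Wall} {h : ℝ} (H : Tracks (orbit P s n) s c 0 h) (h0 : 0 < h) (m : ℕ)
    (h1 : h + m * (s - 3) < 1) : h + (m + 1) * (s - 3) ≠ 1 := by
  intro heq
  refine hc ((H.word_orbit (by linarith) (reads_replicate_three hs h0 m h1)).hitsCorner
    (N := 3) (by linarith) ?_)
  push_cast
  linarith

theorem reads_kindAt {P : Plane} {s : ℝ} (hs : 3 ≤ s) (hs' : s ≤ 3 + 1 / 40)
    (hc : ¬ HitsCorner P s) {n : ℕ} {c : Pose × Set Wall} {h : ℝ}
    (H : Tracks (orbit P s n) s c 0 h) :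
    Reads s (kindAt (s - 3) h).word 0 h 0 ((kindAt (s - 3) h).next (s - 3) h) := by
  have h0 : 0 < h := H.pos_or.resolve_left (lt_irrefl 0)
  have h1 : h < 1 := H.eta_lt
  have long : ∀ (i : Fin 3) (m : ℕ), (i : ℕ) = m → h + m * (s - 3) < 1 →
      ¬ h + (m + 1) * (s - 3) < 1 → Reads s (Kind.word (some i)) 0 h 0 (h + 17 * (s - 3) - 1) := by
    intro i m him hi hi'
    have hne := H.height_ne_one hs hc h0 m hi
    have hgt : 1 < h + (m + 1) * (s - 3) := lt_of_le_of_ne (not_lt.1 hi') hne.symm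
    have r1 := reads_replicate_three hs h0 m hi
    have r2 := reads_columnWord (s := s) (q := 4) (ξ := 0) (η := h + m * (s - 3))
      (by linarith) (by push_cast; linarith) (by push_cast; linarith)
    have hm : ((16 - m : ℕ) : ℝ) = 16 - m := by
      rw [Nat.cast_sub (by omega)]
      norm_num
    have r3 := reads_replicate_three (h := s * (1 - 0) + (h + m * (s - 3)) - (4 : ℕ)) hs
      (by push_cast; linarith) (16 - m) (by rw [hm]; push_cast; nlinarith)
    have := r1.append (r2.append r3)
    rw [hm] at this
    have e : s * (1 - 0) + (h + m * (s - 3)) - (4 : ℕ) + (16 - m) * (s - 3) =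
        h + 17 * (s - 3) - 1 := by
      push_cast
      ring
    rw [e] at this
    simpa only [Kind.word, Kind.columns, List.flatMap_append, List.flatMap_cons, him] using this
  unfold kindAt
  split_ifs with c1 c2 c3
  · have := reads_replicate_three hs h0 3 (by push_cast; linarith)
    push_cast at this
    exact this
  · exact long 2 2 rfl (by push_cast; linarith) (by push_cast; linarith)
  · exact long 1 1 rfl (by push_cast; linarith) (by push_cast; linarith)
  · exact long 0 0 rfl (by push_cast; linarith) (by push_cast; linarith)

section

variable {P : Plane} {s : ℝ} {g : Frame} {n : ℕ} {h : ℝ}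

/-- A block leads to the beginning of another block. -/
theorem Cruise.next (hs : 3 ≤ s) (hs' : s ≤ 3 + 1 / 40) (hc : ¬ HitsCorner P s)
    (H : Cruise P s g n h) :
    Cruise P s (g.shift (kindAt (s - 3) h).disp) (n + (kindAt (s - 3) h).word.length)
      ((kindAt (s - 3) h).next (s - 3) h) := by
  obtain ⟨S, hT, hK⟩ := H
  refine ⟨S \ g.wall '' {u | u ∈ (kindAt (s - 3) h).erased}, ?_, ?_⟩
  · have := hT.word_orbit (by linarith) (reads_kindAt hs hs' hc hT)
    have e := advanceWord_of_simulate hK (kindAt (s - 3) h).simulate_eq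
    rw [show S \ g.wall '' {u | u ∈ ([] : List Wall)} = S by simp] at e
    rwa [e, ← g.pose_shift] at this
  · refine (kindAt (s - 3) h).renews.knows (fun w hw => if_pos ?_) hK
    have : 0 ≤ 2 * (kindAt (s - 3) h).disp.1 + (kindAt (s - 3) h).disp.2 := by
      generalize kindAt (s - 3) h = k
      revert k
      decide
    linarith

theorem Cruise.collides_iff (hs : 3 ≤ s) (hs' : s ≤ 3 + 1 / 40) (hc : ¬ HitsCorner P s) (h : ℝ)
    (r : ℕ) (hr : r < (kindAt (s - 3) h).word.length) :
    ∃ (b : Prop) (u : Wall), (b → u ∈ (kindAt (s - 3) h).erased) ∧ ∀ (g : Frame) (n : ℕ),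
      Cruise P s g n h → ((orbit P s (n + r)).Collides ↔ b) ∧
        wallAt (orbit P s (n + r)).encounterPoint = g.wall u := by
  obtain ⟨b, u, hbu, hall⟩ := (kindAt (s - 3) h).predict r hr
  refine ⟨b, u, hbu, ?_⟩
  rintro g n ⟨S, hT, hK⟩
  obtain ⟨h1, h2⟩ := (hT.word (by linarith) (reads_kindAt hs hs' hc hT)).2 r hr
  rw [orbit_add]
  obtain ⟨h3, h4⟩ := hall g S hK
  exact ⟨h1.trans h3, h2.trans h4⟩

theorem Cruise.collides (hs : 3 ≤ s) (hs' : s ≤ 3 + 1 / 40) (hc : ¬ HitsCorner P s)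
    (H : Cruise P s g n h) : (orbit P s n).Collides := by
  obtain ⟨S, hT, hK⟩ := H
  have hw := reads_kindAt hs hs' hc hT
  have hhead := (kindAt (s - 3) h).head_word
  generalize (kindAt (s - 3) h).word = w at hw hhead
  obtain ⟨t, rfl⟩ := List.head?_eq_some_iff.1 hhead
  rw [(hT.horizontal (by linarith) hw.1).1, g.face_pose]
  exact (hK _ true rfl).2 rfl

theorem Kind.word_length_pos (k : Kind) : 0 < k.word.length := by
  have := k.head_word
  cases hk : k.word with
  | nil => simp [hk] at this
  | cons => simp

/-- Two blocks that begin at the same height have the same future, up to their placement. -/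
theorem Cruise.future (hs : 3 ≤ s) (hs' : s ≤ 3 + 1 / 40) (hc : ¬ HitsCorner P s)
    {g' : Frame} {n' : ℕ} (H : Cruise P s g n h) (H' : Cruise P s g' n' h) (r : ℕ) :
    ((orbit P s (n + r)).Collides ↔ (orbit P s (n' + r)).Collides) ∧
      ∃ u, wallAt (orbit P s (n + r)).encounterPoint = g.wall u ∧
        wallAt (orbit P s (n' + r)).encounterPoint = g'.wall u := by
  induction r using Nat.strong_induction_on generalizing g n h g' n' with
  | _ r ih =>
    by_cases hr : r < (kindAt (s - 3) h).word.length
    · obtain ⟨b, u, -, hall⟩ := Cruise.collides_iff hs hs' hc h r hr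
      obtain ⟨h1, h2⟩ := hall g n H
      obtain ⟨h3, h4⟩ := hall g' n' H'
      exact ⟨h1.trans h3.symm, u, h2, h4⟩
    · have hpos := (kindAt (s - 3) h).word_length_pos
      obtain ⟨h1, u, h2, h3⟩ := ih (r - (kindAt (s - 3) h).word.length) (by omega)
        (H.next hs hs' hc) (H'.next hs hs' hc)
      rw [add_assoc, Nat.add_sub_cancel' (not_lt.1 hr)] at h1 h2
      rw [add_assoc, Nat.add_sub_cancel' (not_lt.1 hr)] at h1 h3
      rw [g.wall_shift] at h2
      rw [g'.wall_shift] at h3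
      exact ⟨h1, _, h2, h3⟩

/-- The deviation of a block from the line of direction `(1 - 8 e, 1 - 5 e)`, corrected by the
height at which it begins. -/
noncomputable def Frame.level (g : Frame) (e h : ℝ) : ℝ :=
  g.y * (1 - 8 * e) - g.x * (1 - 5 * e) + h

/-- The level is an invariant of the digging: the long blocks deviate from the direction
`(1 - 8 e, 1 - 5 e)` precisely as much as the rotation of the heights demands. -/
theorem Frame.level_shift (g : Frame) (e h : ℝ) (k : Kind) :
    (g.shift k.disp).level e (k.next e h) = g.level e h := by
  rcases k with _ | i <;> simp [Frame.level, Frame.shift, Kind.disp, Kind.next] <;> ring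

/-- Every later encounter takes place in some block, and these blocks stay on the same level. -/
theorem Cruise.locate (hs : 3 ≤ s) (hs' : s ≤ 3 + 1 / 40) (hc : ¬ HitsCorner P s)
    (H : Cruise P s g n h) (r : ℕ) :
    ∃ g' n' h' r', Cruise P s g' n' h' ∧ r' < (kindAt (s - 3) h').word.length ∧
      n + r = n' + r' ∧ g'.flipX = g.flipX ∧ g'.flipY = g.flipY ∧ g.x ≤ g'.x ∧
      g'.level (s - 3) h' = g.level (s - 3) h := by
  induction r using Nat.strong_induction_on generalizing g n h with
  | _ r ih =>
    by_cases hr : r < (kindAt (s - 3) h).word.length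
    · exact ⟨g, n, h, r, H, hr, rfl, rfl, rfl, le_rfl, rfl⟩
    · have hpos := (kindAt (s - 3) h).word_length_pos
      obtain ⟨g', n', h', r', h1, h2, h3, h4, h5, h6, h7⟩ :=
        ih (r - (kindAt (s - 3) h).word.length) (by omega) (H.next hs hs' hc)
      refine ⟨g', n', h', r', h1, h2, by omega, h4, h5, le_trans ?_ h6, ?_⟩
      · have : 0 ≤ (kindAt (s - 3) h).disp.1 := by
          generalize kindAt (s - 3) h = k
          revert k
          decide
        exact le_add_of_nonneg_right this
      · rw [h7, g.level_shift]

/-- Blocks begin arbitrarily late. -/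
theorem Cruise.exists_ge (hs : 3 ≤ s) (hs' : s ≤ 3 + 1 / 40) (hc : ¬ HitsCorner P s)
    (H : Cruise P s g n h) (m : ℕ) : ∃ g' n' h', m ≤ n' ∧ Cruise P s g' n' h' ∧
      g'.flipX = g.flipX ∧ g'.flipY = g.flipY ∧ g'.level (s - 3) h' = g.level (s - 3) h := by
  obtain ⟨g', n', h', r', h1, h2, h3, h4, h5, -, h7⟩ := H.locate hs hs' hc m
  exact ⟨_, _, _, by omega, h1.next hs hs' hc, h4, h5, by rw [g'.level_shift, h7]⟩

theorem Cruise.infinite_collisionTimes (hs : 3 ≤ s) (hs' : s ≤ 3 + 1 / 40)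
    (hc : ¬ HitsCorner P s) (H : Cruise P s g n h) : (collisionTimes P s).Infinite := by
  rw [Set.infinite_iff_exists_gt]
  intro m
  obtain ⟨g', n', h', h1, h2, -⟩ := H.exists_ge hs hs' hc (m + 1)
  exact ⟨n', h2.collides hs hs' hc, by omega⟩

end

theorem initialFrame_pose_pose (j : Fin 4) :
    (initialFrame j).pose ((initialFrame j).pose basePose) = ⟨0, 0, true, true⟩ := by
  revert j
  decide

theorem initialFrame_x_nonneg (j : Fin 4) : 0 ≤ ((initialFrame j).shift (initialDisp j)).x := by
  revert j
  decide

/-- For slopes slightly above `3`, the particle eventually digs block after block. -/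
theorem exists_cruise {P : Plane} (hP : ∀ i, P i ∈ Ioo (0 : ℝ) 1) :
    ∃ ε : ℝ, 0 < ε ∧ ε ≤ 1 / 40 ∧ ∀ s ∈ Icc 3 (3 + ε), ¬ HitsCorner P s →
      ∃ g n h, Cruise P s g n h ∧ 0 ≤ g.x := by
  obtain ⟨x0, x1⟩ := hP 0
  obtain ⟨y0, y1⟩ := hP 1
  -- the height at which the line of slope 3 through `P` meets the first vertical grid line
  set L : ℝ := P 1 + 3 * (1 - P 0) with hL
  have hL0 : 0 ≤ L := by linarith
  have f1 := Nat.floor_le hL0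
  have f2 := Nat.lt_floor_add_one L
  have hj : ⌊L⌋₊ < 4 := by
    rw [Nat.floor_lt hL0]
    push_cast
    linarith
  obtain ⟨j, hjL⟩ : ∃ j : Fin 4, (j : ℕ) = ⌊L⌋₊ := ⟨⟨_, hj⟩, rfl⟩
  rw [← hjL] at f1 f2
  -- at most 7 columns precede the first block, and the height stays below 1 until then
  refine ⟨min (1 / 40) ((j + 1 - L) / 16), lt_min (by norm_num) (by linarith), min_le_left _ _, ?_⟩
  rintro s ⟨hs, hs'⟩ hc
  have hsL : s - 3 ≤ (j + 1 - L) / 16 := by linarith [min_le_right (1 / 40) ((j + 1 - L) / 16)]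
  have T := tracks_start hP s
  have hu : s * (1 - P 0) + P 1 = L + (s - 3) * (1 - P 0) := by rw [hL]; ring
  have b0 : 0 ≤ (s - 3) * (1 - P 0) := mul_nonneg (by linarith) (by linarith)
  have b1 : (s - 3) * (1 - P 0) ≤ s - 3 := mul_le_of_le_one_right (by linarith) (by linarith)
  have hlow : ((j : ℕ) : ℝ) < s * (1 - P 0) + P 1 := by
    refine lt_of_le_of_ne (by linarith) fun heq => ?_
    rcases Nat.eq_zero_or_pos (j : ℕ) with h0 | h0
    · rw [h0, Nat.cast_zero] at heq
      have : 0 < s * (1 - P 0) := mul_pos (by linarith) (by linarith)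
      linarith
    · refine hc (Tracks.hitsCorner (n := 0) (N := j - 1) (by linarith) T ?_)
      rw [← heq, Nat.cast_sub h0]
      push_cast
      ring
  have r1 := reads_columnWord (s := s) (q := j) (ξ := P 0) (η := P 1) (by linarith) hlow
    (by linarith)
  have hK : (initialColumns j : ℝ) ≤ 7 := by
    have : ∀ j, initialColumns j ≤ 7 := by decide
    exact_mod_cast this j
  have r2 := reads_replicate_three (h := s * (1 - P 0) + P 1 - (j : ℕ)) hs (by linarith)
    (initialColumns j) (by nlinarith)
  have hT := Tracks.word_orbit (n := 0) (by linarith) T (r1.append r2)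
  have hK0 : (initialFrame j).Knows (fun _ => some true) univ := by
    intro w b hb
    have : true = b := by simpa using hb
    simp [← this]
  have hsim := advanceWord_of_simulate hK0 (simulate_initial j)
  rw [initialFrame_pose_pose, show (univ : Set Wall) \ (initialFrame j).wall '' {u | u ∈ ([] : List Wall)} = univ by
    simp] at hsim
  change Tracks _ _ (advanceWord _ (initialWord j)) _ _ at hT
  rw [hsim, ← Frame.pose_shift] at hT
  exact ⟨_, _, _, ⟨_, hT, (renews_initial j).knows (fun _ _ => rfl) hK0⟩, initialFrame_x_nonneg j⟩

/-! ### Sets of walls and their slopes -/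

theorem finite_walls_of_abs_le (B C : ℝ) :
    {w : Wall | |(w.x : ℝ)| ≤ B ∧ |(w.y : ℝ)| ≤ C}.Finite := by
  have hf : Function.Injective fun w : Wall =>
      ((decide (w.orientation = .vertical), w.x, w.y) : Bool × ℤ × ℤ) := by
    rintro ⟨o, x, y⟩ ⟨o', x', y'⟩ h
    cases o <;> cases o' <;> simp_all
  refine Set.Finite.of_finite_image (f := fun w : Wall =>
    ((decide (w.orientation = .vertical), w.x, w.y) : Bool × ℤ × ℤ)) ?_ hf.injOn
  refine ((finite_univ (α := Bool)).prod ((finite_Icc (-⌈B⌉) ⌈B⌉).prod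
    (finite_Icc (-⌈C⌉) ⌈C⌉))).subset ?_
  rintro _ ⟨w, ⟨h1, h2⟩, rfl⟩
  have h1' := abs_le.1 (h1.trans (Int.le_ceil B))
  have h2' := abs_le.1 (h2.trans (Int.le_ceil C))
  refine ⟨mem_univ _, ⟨?_, ?_⟩, ?_, ?_⟩
  · exact_mod_cast h1'.1
  · exact_mod_cast h1'.2
  · exact_mod_cast h2'.1
  · exact_mod_cast h2'.2

/-- The points of a wall are close to its position. -/
theorem Wall.abs_sub_le {w : Wall} {q : Plane} (hq : q ∈ w.toSet) :
    |q 0 - w.x| ≤ 1 ∧ |q 1 - w.y| ≤ 1 := by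
  rcases w with ⟨o, x, y⟩
  obtain ⟨a, b, ha, hb, hab, rfl⟩ := hq
  have hb1 : b ≤ 1 := by linarith
  have e : ∀ z : ℝ, a * z + b * z - z = 0 := fun z => by rw [← add_mul, hab]; ring
  cases o
  · have e0 : a * (x : ℝ) + b * (x + 1) - x = b := by linear_combination e x
    simp [Wall.farEnd, e, e0, abs_of_nonneg hb, hb1]
  · have e1 : a * (y : ℝ) + b * (y + 1) - y = b := by linear_combination e y
    simp [Wall.farEnd, e, e1, abs_of_nonneg hb, hb1]

theorem abs_apply_le_norm (q : Plane) (i : Fin 2) : |q i| ≤ ‖q‖ := by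
  simpa using PiLp.norm_apply_le q i

theorem norm_le_abs_add_abs (q : Plane) : ‖q‖ ≤ |q 0| + |q 1| := by
  rw [EuclideanSpace.norm_eq, Fin.sum_univ_two, Real.norm_eq_abs, Real.norm_eq_abs]
  apply Real.sqrt_le_iff.2
  constructor
  · positivity
  · nlinarith [abs_nonneg (q 0), abs_nonneg (q 1)]

theorem finite_walls_not_outsideDisc (r : ℝ) : {w : Wall | ¬ w.OutsideDisc r}.Finite := by
  refine (finite_walls_of_abs_le (r + 1) (r + 1)).subset ?_
  intro w hw
  obtain ⟨q, hq, hr⟩ := Set.not_disjoint_iff.1 hw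
  rw [mem_closedBall_zero_iff] at hr
  obtain ⟨h0, h1⟩ := Wall.abs_sub_le hq
  rw [abs_le] at h0 h1
  have q0 := abs_le.1 ((abs_apply_le_norm q 0).trans hr)
  have q1 := abs_le.1 ((abs_apply_le_norm q 1).trans hr)
  exact ⟨abs_le.2 ⟨by linarith, by linarith⟩, abs_le.2 ⟨by linarith, by linarith⟩⟩

theorem eventually_not_outsideDisc (w : Wall) : ∀ᶠ r : ℝ in atTop, ¬ w.OutsideDisc r := by
  filter_upwards [eventually_ge_atTop ‖(!₂[(w.x : ℝ), (w.y : ℝ)] : Plane)‖] with r hr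
  exact Set.not_disjoint_iff.2 ⟨_, left_mem_segment ℝ _ _, mem_closedBall_zero_iff.2 hr⟩

/-- The walls in `T` lie within bounded distance of the ray of direction `(u, v)` from the
origin. -/
def StaysNear (T : Set Wall) (u v : ℝ) : Prop :=
  ∃ C : ℝ, ∀ w ∈ T, ∃ t : ℝ, 0 ≤ t ∧ |w.x - t * u| ≤ C ∧ |w.y - t * v| ≤ C

/-- The walls in `T` lie within bounded distance of the two lines through the origin whose slopes
have absolute value `m`. -/
def NearSlope (T : Set Wall) (m : ℝ) : Prop :=
  ∃ C : ℝ, ∀ w ∈ T, |(|(w.y : ℝ)| - m * |(w.x : ℝ)|)| ≤ C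

theorem StaysNear.nearSlope {T : Set Wall} {u v : ℝ} (h : StaysNear T u v) (hu : u ≠ 0) :
    NearSlope T |v / u| := by
  obtain ⟨C, hC⟩ := h
  refine ⟨C + |v / u| * C, fun w hw => ?_⟩
  obtain ⟨t, ht, h1, h2⟩ := hC w hw
  have a1 := (abs_abs_sub_abs_le (w.x : ℝ) (t * u)).trans h1
  have a2 := (abs_abs_sub_abs_le (w.y : ℝ) (t * v)).trans h2
  rw [abs_mul, abs_of_nonneg ht] at a1 a2
  have e : |(w.y : ℝ)| - |v / u| * |(w.x : ℝ)| =
      (|(w.y : ℝ)| - t * |v|) - |v / u| * (|(w.x : ℝ)| - t * |u|) := by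
    have : |v / u| * |u| = |v| := by rw [← abs_mul, div_mul_cancel₀ _ hu]
    linear_combination (-t) * this
  rw [e]
  refine (abs_sub _ _).trans (add_le_add a2 ?_)
  rw [abs_mul, abs_abs]
  exact mul_le_mul_of_nonneg_left a1 (abs_nonneg _)

/-- An infinite set of walls is near at most one slope. -/
theorem NearSlope.unique {T : Set Wall} (hT : T.Infinite) {m m' : ℝ} (h : NearSlope T m)
    (h' : NearSlope T m') : m = m' := by
  by_contra hne
  obtain ⟨C, hC⟩ := h
  obtain ⟨C', hC'⟩ := h'
  have hpos : 0 < |m - m'| := abs_pos.2 (sub_ne_zero.2 hne)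
  refine hT ((finite_walls_of_abs_le ((C + C') / |m - m'|)
    (C + |m| * ((C + C') / |m - m'|))).subset fun w hw => ?_)
  have h1 := hC w hw
  have h2 := hC' w hw
  have hx : |(w.x : ℝ)| ≤ (C + C') / |m - m'| := by
    rw [le_div_iff₀ hpos]
    calc |(w.x : ℝ)| * |m - m'|
        = |(|(w.y : ℝ)| - m' * |(w.x : ℝ)|) - (|(w.y : ℝ)| - m * |(w.x : ℝ)|)| := by
          rw [← abs_abs (w.x : ℝ), ← abs_mul, abs_abs]
          congr 1
          ring
      _ ≤ C' + C := (abs_sub _ _).trans (add_le_add h2 h1)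
      _ = C + C' := add_comm _ _
  refine ⟨hx, ?_⟩
  have h3 := (abs_le.1 h1).2
  have h4 : m * |(w.x : ℝ)| ≤ |m| * ((C + C') / |m - m'|) :=
    (mul_le_mul_of_nonneg_right (le_abs_self m) (abs_nonneg _)).trans
      (mul_le_mul_of_nonneg_left hx (abs_nonneg m))
  linarith

/-- An arithmetic progression of walls near an irrational slope is constant. -/
theorem eq_zero_of_progression {T : Set Wall} {m : ℝ} (hm : Irrational m) (h : NearSlope T m)
    {W : ℕ → Wall} (hW : ∀ j, W j ∈ T) {d : ℤ × ℤ}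
    (hd : ∀ j, (W j).displacement (W (j + 1)) = d) : d = 0 := by
  have hx : ∀ j, ((W j).x : ℝ) = (W 0).x + j * d.1 := by
    intro j
    induction j with
    | zero => simp
    | succ j ih =>
      have e : (W (j + 1)).x - (W j).x = d.1 := by rw [← hd j]; rfl
      push_cast [← e]
      rw [← e] at ih
      push_cast at ih
      linarith
  have hy : ∀ j, ((W j).y : ℝ) = (W 0).y + j * d.2 := by
    intro j
    induction j with
    | zero => simp
    | succ j ih =>
      have e : (W (j + 1)).y - (W j).y = d.2 := by rw [← hd j]; rfl
      push_cast [← e]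
      rw [← e] at ih
      push_cast at ih
      linarith
  obtain ⟨C, hC⟩ := h
  have key : |(d.2 : ℝ)| - m * |(d.1 : ℝ)| = 0 := by
    by_contra hne
    have hpos : 0 < |(|(d.2 : ℝ)| - m * |(d.1 : ℝ)|)| := abs_pos.2 hne
    obtain ⟨j, hj⟩ := exists_nat_gt
      ((C + |((W 0).y : ℝ)| + |m| * |((W 0).x : ℝ)|) / |(|(d.2 : ℝ)| - m * |(d.1 : ℝ)|)|)
    rw [div_lt_iff₀ hpos] at hj
    have h1 := hC _ (hW j)
    rw [hx, hy] at h1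
    have hj0 : |(j : ℝ)| = j := abs_of_nonneg j.cast_nonneg
    have b1 := abs_abs_sub_abs_le ((j : ℝ) * d.2) ((W 0).y + j * d.2)
    have b2 := abs_abs_sub_abs_le ((W 0).x + (j : ℝ) * d.1) (j * d.1)
    rw [show (j : ℝ) * d.2 - ((W 0).y + j * d.2) = -(W 0).y by ring, abs_neg] at b1
    rw [show (W 0).x + (j : ℝ) * d.1 - j * d.1 = (W 0).x by ring] at b2
    have e : (j : ℝ) * (|(d.2 : ℝ)| - m * |(d.1 : ℝ)|) =
        (|((W 0).y : ℝ) + j * d.2| - m * |((W 0).x : ℝ) + j * d.1|) +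
        (|(j : ℝ) * d.2| - |((W 0).y : ℝ) + j * d.2|) +
        m * (|((W 0).x : ℝ) + j * d.1| - |(j : ℝ) * d.1|) := by
      rw [abs_mul (j : ℝ) d.2, abs_mul (j : ℝ) d.1, hj0]
      ring
    have : (j : ℝ) * |(|(d.2 : ℝ)| - m * |(d.1 : ℝ)|)| ≤
        C + |((W 0).y : ℝ)| + |m| * |((W 0).x : ℝ)| := by
      rw [show (j : ℝ) * |(|(d.2 : ℝ)| - m * |(d.1 : ℝ)|)| =
        |(j : ℝ) * (|(d.2 : ℝ)| - m * |(d.1 : ℝ)|)| by rw [abs_mul, hj0], e]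
      refine (abs_add_le _ _).trans (add_le_add ((abs_add_le _ _).trans (add_le_add h1 b1)) ?_)
      rw [abs_mul]
      exact mul_le_mul_of_nonneg_left b2 (abs_nonneg m)
    linarith
  have h1 : d.1 = 0 := by
    by_contra hne
    have hne' : |(d.1 : ℝ)| ≠ 0 := by simpa using hne
    refine hm ⟨(|d.2| : ℤ) / (|d.1| : ℤ), ?_⟩
    push_cast
    rw [div_eq_iff hne']
    linarith
  have h2 : d.2 = 0 := by
    rw [h1] at key
    simpa using key
  exact Prod.ext h1 h2

/-- A set of walls near a ray is contained in a band of that direction. -/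
theorem StaysNear.exists_band {T : Set Wall} {u v : ℝ} (h : StaysNear T u v) (hu : u ≠ 0) :
    ∃ b : Band, b.HasAbsSlope |v / u| ∧ ∀ w ∈ T, w.toSet ⊆ b.toSet := by
  obtain ⟨C, hC⟩ := h
  refine ⟨⟨0, !₂[u, v], fun h0 => hu (by simpa using congrArg (fun q : Plane => q 0) h0),
    2 * C + 2⟩, ⟨by simpa using hu, by simp⟩, fun w hw q hq => ?_⟩
  obtain ⟨t, ht, h1, h2⟩ := hC w hw
  obtain ⟨q0, q1⟩ := Wall.abs_sub_le hq
  refine Metric.mem_cthickening_of_dist_le q (t • !₂[u, v]) _ _ ⟨t, ht, by simp⟩ ?_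
  rw [dist_eq_norm]
  refine (norm_le_abs_add_abs _).trans ?_
  have e0 : (q - t • !₂[u, v]) 0 = (q 0 - w.x) + (w.x - t * u) := by simp
  have e1 : (q - t • !₂[u, v]) 1 = (q 1 - w.y) + (w.y - t * v) := by simp
  rw [e0, e1]
  linarith [abs_add_le (q 0 - w.x) (w.x - t * u), abs_add_le (q 1 - w.y) (w.y - t * v)]

/-! ### The sequence of collisions -/

section

variable {P : Plane} {s : ℝ}

theorem solid_step_subset (st : State) : st.step.solid ⊆ st.solid := by
  unfold State.step
  split_ifs
  · exact Subset.rfl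
  · exact sdiff_subset
  · exact Subset.rfl

theorem antitone_solid (P : Plane) (s : ℝ) : Antitone fun n => (orbit P s n).solid := by
  refine antitone_nat_of_succ_le fun n => ?_
  rw [orbit, Function.iterate_succ_apply']
  exact solid_step_subset _

/-- A wall that has been hit is erased for good. -/
theorem wallAt_notMem_solid {m n : ℕ} (hm : m ∈ collisionTimes P s) (hmn : m < n) :
    wallAt (orbit P s m).encounterPoint ∉ (orbit P s n).solid := by
  intro hn
  have h1 := antitone_solid P s (Nat.succ_le_of_lt hmn) hn
  have hm' : (orbit P s m).Collides := hm
  simp only [orbit, Nat.succ_eq_add_one, Function.iterate_succ_apply'] at h1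
  change _ ∈ ((orbit P s m).step).solid at h1
  rw [State.step, if_neg hm'.1, if_pos hm'] at h1
  exact h1.2 rfl

theorem injOn_wallAt (P : Plane) (s : ℝ) :
    InjOn (fun n => wallAt (orbit P s n).encounterPoint) (collisionTimes P s) := by
  intro m hm n hn hmn
  dsimp only at hmn
  rcases lt_trichotomy m n with h | h | h
  · refine absurd ?_ (wallAt_notMem_solid hm h)
    rw [hmn]
    exact hn.2.2
  · exact h
  · refine absurd ?_ (wallAt_notMem_solid hn h)
    rw [← hmn]
    exact hm.2.2

theorem infinite_erasedWalls (h : (collisionTimes P s).Infinite) : (erasedWalls P s).Infinite :=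
  h.image (injOn_wallAt P s)

theorem nth_mem_collisionTimes (h : (collisionTimes P s).Infinite) (n : ℕ) :
    Nat.nth (· ∈ collisionTimes P s) n ∈ collisionTimes P s :=
  Nat.nth_mem_of_infinite h n

theorem collisionWall_mem (h : (collisionTimes P s).Infinite) (n : ℕ) :
    collisionWall P s n ∈ erasedWalls P s :=
  ⟨_, nth_mem_collisionTimes h n, rfl⟩

theorem collisionWall_injective (h : (collisionTimes P s).Infinite) :
    Function.Injective (collisionWall P s) := fun _ _ hmn =>
  Nat.nth_injective h (injOn_wallAt P s (nth_mem_collisionTimes h _) (nth_mem_collisionTimes h _)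
    hmn)

theorem eventually_outsideDisc (h : (collisionTimes P s).Infinite) (r : ℝ) :
    ∀ᶠ n in atTop, (collisionWall P s n).OutsideDisc r := by
  rw [← Nat.cofinite_eq_atTop]
  have := (finite_walls_not_outsideDisc r).preimage (collisionWall_injective h).injOn
  simpa [Filter.eventually_cofinite] using this

/-- A family of bands that contains all distant erased walls is nonempty. -/
theorem CoversOutside.pos (h : (collisionTimes P s).Infinite) {N : ℕ} {b : Fin N → Band} {r : ℝ}
    (hb : CoversOutside P s b r) : 0 < N := by
  obtain ⟨n, hn⟩ := (eventually_outsideDisc h r).exists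
  obtain ⟨i, -⟩ := hb _ (collisionWall_mem h n) hn
  exact i.pos

/-- Walls near a ray form a tunnel with a single band. -/
theorem StaysNear.exists_isTunnel (hinf : (collisionTimes P s).Infinite) {u v : ℝ}
    (h : StaysNear (erasedWalls P s) u v) (hu : u ≠ 0) :
    ∃ b : Fin 1 → Band, IsTunnel P s b ∧ ∀ i, (b i).HasAbsSlope |v / u| := by
  obtain ⟨b, h1, h2⟩ := h.exists_band hu
  exact ⟨fun _ => b, ⟨hinf, ⟨0, fun w hw _ => ⟨0, h2 w hw⟩⟩, fun M b' ⟨r, hr⟩ => hr.pos hinf⟩,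
    fun _ => h1⟩

/-- A tunnel near an irrational slope is not periodic: a period would make some erased walls form
an arithmetic progression. -/
theorem not_tunnelsPeriodically {b₁ : Fin 1 → Band} (h₁ : IsTunnel P s b₁) {m : ℝ}
    (hm : Irrational m) (h : NearSlope (erasedWalls P s) m) : ¬ TunnelsPeriodically P s := by
  rintro ⟨N, b, ⟨hinf, ⟨r₀, hr₀⟩, hmin⟩, hper⟩
  have hN : N ≤ 1 := hmin 1 b₁ h₁.2.1
  obtain ⟨r, ⟨k, hk, d, hd⟩, hr⟩ := (hper.and (eventually_ge_atTop r₀)).exists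
  obtain ⟨n₀, hn₀⟩ := eventually_atTop.1 (eventually_outsideDisc hinf r)
  have i₀ : Fin N := ⟨0, hr₀.pos hinf⟩
  have hdisp : ∀ n, n₀ ≤ n →
      (collisionWall P s n).displacement (collisionWall P s (n + k)) = d i₀ := by
    intro n hn
    have hout := hn₀ n hn
    obtain ⟨i, hi⟩ := hr₀ _ (collisionWall_mem hinf n)
      (Disjoint.mono_right (Metric.closedBall_subset_closedBall hr) hout)
    rw [(hd n hout).2 i hi]
    congr 1
    apply Fin.ext
    omega
  have h0 : d i₀ = 0 := by
    refine eq_zero_of_progression hm h (W := fun j => collisionWall P s (n₀ + j * k))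
      (fun j => collisionWall_mem hinf _) fun j => ?_
    have := hdisp (n₀ + j * k) (Nat.le_add_right _ _)
    rwa [add_assoc, ← Nat.succ_mul] at this
  have h1 := hdisp n₀ le_rfl
  rw [h0] at h1
  have h2 := (hd n₀ (hn₀ n₀ le_rfl)).1
  have h3 : collisionWall P s (n₀ + k) = collisionWall P s n₀ := by
    simp only [Wall.displacement, Prod.mk_eq_zero] at h1
    revert h1 h2
    generalize collisionWall P s (n₀ + k) = w
    generalize collisionWall P s n₀ = w'
    rintro h3 ⟨h1, h2⟩
    rcases w with ⟨o, x, y⟩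
    rcases w' with ⟨o', x', y'⟩
    exact (Wall.mk.injEq ..).mpr ⟨h3, sub_eq_zero.1 h1, sub_eq_zero.1 h2⟩
  have := collisionWall_injective hinf h3
  omega

/-- If the collisions after encounter `n'` repeat those after encounter `n`, then the sequence of
collisions is eventually periodic. -/
theorem exists_period {n n' : ℕ} (hn : n < n') (hinf : (collisionTimes P s).Infinite)
    {R : Wall → Wall → Prop}
    (hrep : ∀ r, ((orbit P s (n + r)).Collides ↔ (orbit P s (n' + r)).Collides) ∧
      R (wallAt (orbit P s (n + r)).encounterPoint) (wallAt (orbit P s (n' + r)).encounterPoint)) :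
    ∃ m₀ k, 0 < k ∧ ∀ m, m₀ ≤ m → R (collisionWall P s m) (collisionWall P s (m + k)) := by
  classical
  let p : ℕ → Prop := (· ∈ collisionTimes P s)
  have hp : {n | p n}.Infinite := hinf
  have hcount : ∀ r, Nat.count p (n' + r) + Nat.count p n = Nat.count p n' + Nat.count p (n + r) := by
    intro r
    induction r with
    | zero => simp
    | succ r ih =>
      rw [← add_assoc, ← add_assoc, Nat.count_succ, Nat.count_succ]
      have : p (n' + r) ↔ p (n + r) := (hrep r).1.symm
      simp only [this]
      omega
  have hmono : Nat.count p n ≤ Nat.count p n' := Nat.count_monotone p hn.le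
  refine ⟨Nat.count p n, Nat.count p n' - Nat.count p n, ?_, ?_⟩
  · by_contra hk
    -- otherwise there are no collisions at all from encounter `n` on
    have hk' : Nat.count p n' = Nat.count p n := by omega
    have hall : ∀ j, Nat.count p (n + j * (n' - n)) = Nat.count p n := by
      intro j
      induction j with
      | zero => simp
      | succ j ih =>
        have := hcount (j * (n' - n))
        have e : n + (j + 1) * (n' - n) = n' + j * (n' - n) := by
          rw [Nat.succ_mul]
          omega
        rw [e]
        omega
    have h1 := hall (Nat.nth p (Nat.count p n) + 1)
    have h2 : Nat.nth p (Nat.count p n) + 1 ≤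
        n + (Nat.nth p (Nat.count p n) + 1) * (n' - n) :=
      (Nat.le_mul_of_pos_right _ (by omega)).trans (Nat.le_add_left _ _)
    have h3 := Nat.count_monotone p h2
    rw [Nat.count_nth_succ_of_infinite hp, h1] at h3
    omega
  · intro m hm
    have hmem : p (Nat.nth p m) := Nat.nth_mem_of_infinite hp m
    have hge : n ≤ Nat.nth p m := by
      by_contra! hlt
      have := Nat.count_strict_mono hmem hlt
      rw [Nat.count_nth_of_infinite hp] at this
      omega
    obtain ⟨r, hr⟩ := Nat.exists_eq_add_of_le hge
    have hmem' : p (n' + r) := (hrep r).1.1 (by rw [← hr]; exact hmem)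
    have e : Nat.nth p (m + (Nat.count p n' - Nat.count p n)) = n' + r := by
      have h1 := hcount r
      rw [← hr, Nat.count_nth_of_infinite hp] at h1
      rw [← Nat.nth_count hmem']
      congr 1
      omega
    have h2 := (hrep r).2
    rw [← hr, ← e] at h2
    exact h2

/-- A tunnel with a single band and an eventually periodic sequence of collisions is periodic. -/
theorem IsTunnel.tunnelsPeriodically {b : Fin 1 → Band} (h : IsTunnel P s b) {m₀ k : ℕ} (hk : 0 < k)
    {d : ℤ × ℤ} (hper : ∀ m, m₀ ≤ m →
      (collisionWall P s (m + k)).orientation = (collisionWall P s m).orientation ∧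
      (collisionWall P s m).displacement (collisionWall P s (m + k)) = d) :
    TunnelsPeriodically P s := by
  refine ⟨1, b, h, ?_⟩
  have hev : ∀ᶠ r : ℝ in atTop, ∀ m ∈ Finset.range m₀, ¬ (collisionWall P s m).OutsideDisc r :=
    (Filter.eventually_all_finset _).2 fun m _ => eventually_not_outsideDisc _
  filter_upwards [hev] with r hr
  refine ⟨k, hk, fun _ => d, fun n hn => ?_⟩
  have hm : m₀ ≤ n := by
    by_contra! hlt
    exact hr n (Finset.mem_range.2 hlt) hn
  exact ⟨(hper n hm).1, fun _ _ => (hper n hm).2⟩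

end

/-! ### The tunnel -/

/-- The sign of a direction that is possibly reversed. -/
noncomputable def flipSign (b : Bool) : ℝ := if b then -1 else 1

theorem abs_flipSign (b : Bool) : |flipSign b| = 1 := by
  cases b <;> simp [flipSign]

theorem abs_flipCell_sub_le (b : Bool) (a c : ℤ) (t : ℝ) :
    |(flipCell b (a + c) : ℝ) - t * flipSign b| ≤ |(a : ℝ)| + |c - t| := by
  have h : |((a : ℝ) + c) - t| ≤ |(a : ℝ)| + |c - t| := by
    rw [add_sub_assoc]
    exact abs_add_le _ _
  cases b
  · simpa [flipCell, flipSign] using h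
  · rw [← abs_neg]
    simp only [flipCell, flipSign, if_true]
    push_cast
    rwa [show -(-((a : ℝ) + c) - t * -1) = a + c - t by ring]

theorem abs_flipLine_sub_le (b : Bool) (a c : ℤ) (t : ℝ) :
    |(flipLine b (a + c) : ℝ) - t * flipSign b| ≤ |(a : ℝ)| + |c - t| + 1 := by
  have h := abs_flipCell_sub_le b a c t
  cases b
  · simp only [flipLine, flipCell, Bool.false_eq_true, if_false] at h ⊢
    linarith
  · simp only [flipLine, flipCell, if_true] at h ⊢
    push_cast
    have := abs_add_le (-((a : ℝ) + c) - t * flipSign true) 1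
    rw [abs_one] at this
    rw [show (1 : ℝ) - (a + c) - t * flipSign true = -((a : ℝ) + c) - t * flipSign true + 1 by ring]
    push_cast at h
    linarith

theorem Frame.abs_wall_sub_le (g : Frame) (w : Wall) (t t' : ℝ) :
    |((g.wall w).x : ℝ) - t * flipSign g.flipX| ≤ |(w.x : ℝ)| + |g.x - t| + 1 ∧
      |((g.wall w).y : ℝ) - t' * flipSign g.flipY| ≤ |(w.y : ℝ)| + |g.y - t'| + 1 := by
  rcases w with ⟨o, a, b⟩
  cases o
  · exact ⟨(abs_flipCell_sub_le _ _ _ _).trans (by simp), abs_flipLine_sub_le _ _ _ _⟩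
  · exact ⟨abs_flipLine_sub_le _ _ _ _, (abs_flipCell_sub_le _ _ _ _).trans (by simp)⟩

section

variable {P : Plane} {s : ℝ} {g : Frame} {n : ℕ} {h : ℝ}

theorem Cruise.height_mem (H : Cruise P s g n h) : h ∈ Ioo (0 : ℝ) 1 := by
  obtain ⟨S, hT, -⟩ := H
  exact ⟨hT.pos_or.resolve_left (lt_irrefl 0), hT.eta_lt⟩

/-- All the erased walls stay near the ray whose direction is `(1 - 8 e, 1 - 5 e)` up to signs. -/
theorem Cruise.staysNear (hs : 3 ≤ s) (hs' : s ≤ 3 + 1 / 40) (hc : ¬ HitsCorner P s)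
    (H : Cruise P s g n h) (hg : 0 ≤ g.x) :
    StaysNear (erasedWalls P s) (flipSign g.flipX * (1 - 8 * (s - 3)))
      (flipSign g.flipY * (1 - 5 * (s - 3))) := by
  set e := s - 3 with he
  have h8 : 0 < 1 - 8 * e := by linarith
  -- finitely many walls are hit before the blocks begin
  obtain ⟨B, hB⟩ := ((Finset.range n).image fun m =>
    |((wallAt (orbit P s m).encounterPoint).x : ℝ)| +
      |((wallAt (orbit P s m).encounterPoint).y : ℝ)|).bddAbove
  set D : ℝ := (|g.level e h| + 1) / (1 - 8 * e) with hD
  have hD0 : 0 ≤ D := by positivity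
  refine ⟨max B (8 + D), ?_⟩
  rintro _ ⟨m, hm, rfl⟩
  rcases lt_or_ge m n with hmn | hmn
  · have := hB (Finset.mem_coe.2 (Finset.mem_image_of_mem _ (Finset.mem_range.2 hmn)))
    refine ⟨0, le_rfl, ?_, ?_⟩
    · rw [zero_mul, sub_zero]
      exact le_trans (by linarith [abs_nonneg ((wallAt (orbit P s m).encounterPoint).y : ℝ)])
        (le_max_left _ _)
    · rw [zero_mul, sub_zero]
      exact le_trans (by linarith [abs_nonneg ((wallAt (orbit P s m).encounterPoint).x : ℝ)])
        (le_max_left _ _)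
  · obtain ⟨r, rfl⟩ := Nat.exists_eq_add_of_le hmn
    obtain ⟨g', n', h', r', H', hr', hrr, hx, hy, hgx, hlev⟩ := H.locate hs hs' hc r
    obtain ⟨b, u, hbu, hall⟩ := Cruise.collides_iff hs hs' hc h' r' hr'
    obtain ⟨h1, h2⟩ := hall g' n' H'
    rw [← hrr] at h1 h2
    obtain ⟨ux, uy⟩ := (kindAt (s - 3) h').abs_erased_le u (hbu (h1.1 hm))
    have ux' : |(u.x : ℝ)| ≤ 7 := by exact_mod_cast ux
    have uy' : |(u.y : ℝ)| ≤ 7 := by exact_mod_cast uy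
    have hg' : (0 : ℝ) ≤ g'.x := by exact_mod_cast hg.trans hgx
    set t : ℝ := g'.x / (1 - 8 * e) with ht
    have htx : t * (1 - 8 * e) = g'.x := div_mul_cancel₀ _ h8.ne'
    refine ⟨t, div_nonneg hg' h8.le, ?_⟩
    obtain ⟨w1, w2⟩ := g'.abs_wall_sub_le u (t * (1 - 8 * e)) (t * (1 - 5 * e))
    have hdev : |(g'.y : ℝ) - t * (1 - 5 * e)| ≤ D := by
      have e1 : (g'.y : ℝ) - t * (1 - 5 * e) = (g.level e h - h') / (1 - 8 * e) := by
        rw [eq_div_iff h8.ne', ← hlev, Frame.level]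
        linear_combination (-(1 - 5 * e)) * htx
      rw [e1, abs_div, abs_of_pos h8, hD]
      have := abs_sub (g.level e h) h'
      rw [abs_of_pos H'.height_mem.1] at this
      have := H'.height_mem.2
      gcongr
      linarith
    rw [htx, sub_self, abs_zero] at w1
    rw [h2, ← hx, ← hy]
    constructor
    · rw [show t * (flipSign g'.flipX * (1 - 8 * e)) = g'.x * flipSign g'.flipX by
        rw [← htx]; ring]
      exact le_trans (by linarith) (le_max_right _ _)
    · rw [show t * (flipSign g'.flipY * (1 - 5 * e)) = t * (1 - 5 * e) * flipSign g'.flipY by ring]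
      exact le_trans (by linarith) (le_max_right _ _)

theorem Frame.displacement_wall {g g' : Frame} (hx : g'.flipX = g.flipX) (hy : g'.flipY = g.flipY)
    (u : Wall) : (g'.wall u).orientation = (g.wall u).orientation ∧
      (g.wall u).displacement (g'.wall u) =
        (flipCell g.flipX (g'.x - g.x), flipCell g.flipY (g'.y - g.y)) := by
  rcases g with ⟨fx, fy, x, y⟩
  rcases g' with ⟨fx', fy', x', y'⟩
  obtain rfl : fx' = fx := hx
  obtain rfl : fy' = fy := hy
  rcases u with ⟨o, a, b⟩
  cases o <;> refine ⟨rfl, ?_⟩ <;> cases fx' <;> cases fy' <;>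
    simp [Frame.wall, Wall.displacement, flipCell, flipLine] <;> omega

/-- For a rational slope, two blocks begin at the same height. -/
theorem Cruise.exists_same_height (hs : 3 ≤ s) (hs' : s ≤ 3 + 1 / 40) (hc : ¬ HitsCorner P s)
    (H : Cruise P s g n h) {q : ℚ} (hq : (q : ℝ) = s) :
    ∃ g₁ n₁ g₂ n₂ h', Cruise P s g₁ n₁ h' ∧ Cruise P s g₂ n₂ h' ∧ n₁ < n₂ ∧
      g₂.flipX = g₁.flipX ∧ g₂.flipY = g₁.flipY := by
  set I := g.level (s - 3) h with hI
  have hden : (0 : ℝ) < q.den := by exact_mod_cast q.pos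
  have hnum : (q.den : ℝ) * s = q.num := by
    rw [← hq]
    exact_mod_cast q.den_mul_eq_num
  -- the heights differ from the level by multiples of the inverse of the denominator
  set F : Set ℝ := (fun z : ℤ => I + z / q.den) '' Icc ⌊q.den * (-I)⌋ ⌈q.den * (1 - I)⌉ with hF
  have hFfin : F.Finite := (finite_Icc _ _).image _
  have hmem : ∀ {g' n' h'}, Cruise P s g' n' h' → g'.level (s - 3) h' = I → h' ∈ F := by
    intro g' n' h' H' hlev
    obtain ⟨h0, h1⟩ := H'.height_mem
    have hz : q.den * (h' - I) =
        ((g'.x * (16 * q.den - 5 * q.num) - g'.y * (25 * q.den - 8 * q.num) : ℤ) : ℝ) := by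
      rw [← hlev, Frame.level]
      push_cast
      linear_combination (5 * (g'.x : ℝ) - 8 * g'.y) * (-1) * hnum
    refine ⟨g'.x * (16 * q.den - 5 * q.num) - g'.y * (25 * q.den - 8 * q.num), ⟨?_, ?_⟩, ?_⟩
    · rw [Int.floor_le_iff, ← hz]
      nlinarith
    · rw [Int.le_ceil_iff, ← hz]
      nlinarith
    · dsimp only
      rw [← hz, mul_div_cancel_left₀ _ hden.ne']
      ring
  set A : Set ℕ := {m | ∃ g' h', Cruise P s g' m h' ∧ g'.flipX = g.flipX ∧ g'.flipY = g.flipY ∧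
    g'.level (s - 3) h' = I} with hA
  have hAinf : A.Infinite := by
    rw [Set.infinite_iff_exists_gt]
    intro m
    obtain ⟨g', n', h', h1, h2, h3⟩ := H.exists_ge hs hs' hc (m + 1)
    exact ⟨n', ⟨g', h', h2, h3⟩, by omega⟩
  choose! G K hGK using fun m (hm : m ∈ A) => hm
  obtain ⟨m₁, hm₁, m₂, hm₂, hne, heq⟩ := hAinf.exists_ne_map_eq_of_mapsTo (f := K) (t := F)
    (fun m hm => hmem (hGK m hm).1 (hGK m hm).2.2.2) hFfin
  obtain ⟨a1, a2, a3, -⟩ := hGK m₁ hm₁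
  obtain ⟨b1, b2, b3, -⟩ := hGK m₂ hm₂
  rw [heq] at a1
  rcases lt_or_gt_of_ne hne with hlt | hlt
  · exact ⟨_, _, _, _, _, a1, b1, hlt, b2.trans a2.symm, b3.trans a3.symm⟩
  · exact ⟨_, _, _, _, _, b1, a1, hlt, a2.trans b2.symm, a3.trans b3.symm⟩

/-- A repeated height makes the tunnel periodic. -/
theorem Cruise.tunnelsPeriodically (hs : 3 ≤ s) (hs' : s ≤ 3 + 1 / 40) (hc : ¬ HitsCorner P s)
    (H : Cruise P s g n h) {b : Fin 1 → Band} (hb : IsTunnel P s b) {q : ℚ} (hq : (q : ℝ) = s) :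
    TunnelsPeriodically P s := by
  obtain ⟨g₁, n₁, g₂, n₂, h', H₁, H₂, hlt, hx, hy⟩ := H.exists_same_height hs hs' hc hq
  obtain ⟨m₀, k, hk, hper⟩ := exists_period hlt hb.1
    (R := fun w w' => ∃ u, w = g₁.wall u ∧ w' = g₂.wall u) fun r => by
      obtain ⟨h1, u, h2, h3⟩ := H₁.future hs hs' hc H₂ r
      exact ⟨h1, u, h2, h3⟩
  refine hb.tunnelsPeriodically hk (m₀ := m₀)
    (d := (flipCell g₁.flipX (g₂.x - g₁.x), flipCell g₁.flipY (g₂.y - g₁.y))) fun m hm => ?_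
  obtain ⟨u, h1, h2⟩ := hper m hm
  rw [h1, h2]
  exact Frame.displacement_wall hx hy u

end

/-- The slope of the tunnel. -/
noncomputable def tunnelSlope (s : ℝ) : ℝ := 1 + (3 * s - 9) / (25 - 8 * s)

theorem tunnelSlope_eq {s : ℝ} (hs : s ≤ 3 + 1 / 40) :
    tunnelSlope s = (1 - 5 * (s - 3)) / (1 - 8 * (s - 3)) := by
  have h1 : 25 - 8 * s ≠ 0 := by linarith
  have h2 : 1 - 8 * (s - 3) ≠ 0 := by linarith
  rw [tunnelSlope, eq_div_iff h2, show 1 - 8 * (s - 3) = 25 - 8 * s by ring, add_mul,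
    div_mul_cancel₀ _ h1]
  ring

/-- The slope of the trajectory in terms of the slope of the tunnel. -/
theorem eq_of_tunnelSlope {s : ℝ} (hs : 3 ≤ s) (hs' : s ≤ 3 + 1 / 40) :
    s = (25 * tunnelSlope s - 16) / (8 * tunnelSlope s - 5) := by
  have h1 : 0 < 25 - 8 * s := by linarith
  have h2 : 0 ≤ (3 * s - 9) / (25 - 8 * s) := div_nonneg (by linarith) h1.le
  have h3 : tunnelSlope s - 1 = (3 * s - 9) / (25 - 8 * s) := by rw [tunnelSlope]; ring
  rw [eq_div_iff (by linarith)]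
  rw [eq_div_iff h1.ne'] at h3
  linarith

theorem irrational_tunnelSlope {s : ℝ} (hs : 3 ≤ s) (hs' : s ≤ 3 + 1 / 40) (h : Irrational s) :
    Irrational (tunnelSlope s) := by
  rintro ⟨q, hq⟩
  refine h ⟨(25 * q - 16) / (8 * q - 5), ?_⟩
  rw [eq_of_tunnelSlope hs hs', ← hq]
  push_cast
  rfl

/-- What is known about the tunnel for a slope slightly above `3`. -/
theorem Cruise.tunnel {P : Plane} {s : ℝ} {g : Frame} {n : ℕ} {h : ℝ} (hs : 3 ≤ s)
    (hs' : s ≤ 3 + 1 / 40) (hc : ¬ HitsCorner P s) (H : Cruise P s g n h) (hg : 0 ≤ g.x) :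
    (∃ b : Fin 1 → Band, IsTunnel P s b ∧ ∀ i, (b i).HasAbsSlope (tunnelSlope s)) ∧
      NearSlope (erasedWalls P s) (tunnelSlope s) := by
  have hnear := H.staysNear hs hs' hc hg
  have hu : flipSign g.flipX * (1 - 8 * (s - 3)) ≠ 0 := by
    refine mul_ne_zero ?_ (by linarith)
    cases g.flipX <;> simp [flipSign]
  have hm : |flipSign g.flipY * (1 - 5 * (s - 3)) / (flipSign g.flipX * (1 - 8 * (s - 3)))| =
      tunnelSlope s := by
    rw [abs_div, abs_mul, abs_mul, abs_flipSign, abs_flipSign, one_mul, one_mul,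
      abs_of_pos (by linarith), abs_of_pos (by linarith), tunnelSlope_eq hs']
  rw [← hm]
  exact ⟨hnear.exists_isTunnel (H.infinite_collisionTimes hs hs' hc) hu, hnear.nearSlope hu⟩

end Breakout

theorem theorem1p2 (P : Breakout.Plane) (hP : ∀ i, P i ∈ Set.Ioo (0 : ℝ) 1) :
    ∃ ε : ℝ, 0 < ε ∧ ε ≤ 1 / 17 ∧
      {s : ℝ | s ∈ Set.Icc 3 (3 + ε) ∧ Breakout.HitsCorner P s}.Countable ∧
      (∀ s ∈ Set.Icc 3 (3 + ε), ¬ Breakout.HitsCorner P s →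
        Breakout.TunnelsWithSlope P s (1 + (3 * s - 9) / (25 - 8 * s)) ∧
        ((∃ q : ℚ, (q : ℝ) = s) → Breakout.TunnelsPeriodically P s) ∧
        (Irrational s → Breakout.TunnelsAperiodically P s)) ∧
      ¬ {s : ℝ | s ∈ Set.Icc 3 (3 + ε) ∧ Breakout.TunnelsAperiodically P s}.Countable ∧
      ¬ {T : Set Breakout.Wall | ∃ s ∈ Set.Icc 3 (3 + ε),
          Breakout.TunnelsAperiodically P s ∧ Breakout.erasedWalls P s = T}.Countable := by
  obtain ⟨ε, hε0, hε1, hcruise⟩ := Breakout.exists_cruise hP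
  have le40 : ∀ {s : ℝ}, s ∈ Set.Icc 3 (3 + ε) → s ≤ 3 + 1 / 40 := fun hs => by linarith [hs.2]
  have hcount : {s : ℝ | s ∈ Set.Icc 3 (3 + ε) ∧ Breakout.HitsCorner P s}.Countable :=
    (Breakout.countable_hitsCorner hP).mono fun s hs =>
      show 0 < s ∧ Breakout.HitsCorner P s from ⟨by linarith [hs.1.1], hs.2⟩
  have haper : ∀ s ∈ Set.Icc 3 (3 + ε), ¬ Breakout.HitsCorner P s → Irrational s →
      Breakout.TunnelsAperiodically P s := by
    intro s hs hc hirr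
    obtain ⟨g, n, h, H, hg⟩ := hcruise s hs hc
    obtain ⟨⟨b, hb, -⟩, hnear⟩ := H.tunnel hs.1 (le40 hs) hc hg
    exact ⟨⟨1, b, hb⟩, Breakout.not_tunnelsPeriodically hb
      (Breakout.irrational_tunnelSlope hs.1 (le40 hs) hirr) hnear⟩
  -- the irrational slopes for which the particle hits no corner
  set U : Set ℝ := Set.Icc 3 (3 + ε) \
    ({s : ℝ | s ∈ Set.Icc 3 (3 + ε) ∧ Breakout.HitsCorner P s} ∪ Set.range ((↑) : ℚ → ℝ)) with hU
  have hUmem : ∀ {s}, s ∈ U → s ∈ Set.Icc 3 (3 + ε) ∧ ¬ Breakout.HitsCorner P s ∧ Irrational s :=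
    fun hs => ⟨hs.1, fun hc => hs.2 (Or.inl ⟨hs.1, hc⟩), fun hq => hs.2 (Or.inr hq)⟩
  have hUunc : ¬ U.Countable := by
    intro hcountU
    have h1 : (Set.Icc 3 (3 + ε)).Countable :=
      (hcountU.union (hcount.union (Set.countable_range ((↑) : ℚ → ℝ)))).mono fun s hs => by
        by_cases h2 : s ∈ {s : ℝ | s ∈ Set.Icc 3 (3 + ε) ∧ Breakout.HitsCorner P s} ∪
          Set.range ((↑) : ℚ → ℝ)
        · exact Or.inr h2
        · exact Or.inl ⟨hs, h2⟩
    rw [← Cardinal.le_aleph0_iff_set_countable, Cardinal.mk_Icc_real (by linarith)] at h1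
    exact absurd h1 (not_le.2 Cardinal.aleph0_lt_continuum)
  -- the erased walls determine the slope of the tunnel, and hence the slope of the trajectory
  have hinj : Set.InjOn (Breakout.erasedWalls P) U := by
    intro s hs s' hs' heq
    obtain ⟨i1, c1, -⟩ := hUmem hs
    obtain ⟨i2, c2, -⟩ := hUmem hs'
    obtain ⟨g, n, h, H, hg⟩ := hcruise s i1 c1
    obtain ⟨g', n', h', H', hg'⟩ := hcruise s' i2 c2
    have n1 := (H.tunnel i1.1 (le40 i1) c1 hg).2
    have n2 := (H'.tunnel i2.1 (le40 i2) c2 hg').2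
    rw [← heq] at n2
    have := n1.unique (Breakout.infinite_erasedWalls
      (H.infinite_collisionTimes i1.1 (le40 i1) c1)) n2
    rw [Breakout.eq_of_tunnelSlope i1.1 (le40 i1), this,
      ← Breakout.eq_of_tunnelSlope i2.1 (le40 i2)]
  refine ⟨ε, hε0, by linarith, hcount, fun s hs hc => ⟨?_, ?_, haper s hs hc⟩, ?_, ?_⟩
  · obtain ⟨g, n, h, H, hg⟩ := hcruise s hs hc
    obtain ⟨⟨b, hb, hslope⟩, -⟩ := H.tunnel hs.1 (le40 hs) hc hg
    exact ⟨1, b, hb, hslope⟩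
  · rintro ⟨q, hq⟩
    obtain ⟨g, n, h, H, hg⟩ := hcruise s hs hc
    obtain ⟨⟨b, hb, -⟩, -⟩ := H.tunnel hs.1 (le40 hs) hc hg
    exact H.tunnelsPeriodically hs.1 (le40 hs) hc hb hq
  · refine fun hcountA => hUunc (hcountA.mono fun s hs => ?_)
    obtain ⟨i1, c1, r1⟩ := hUmem hs
    exact ⟨i1, haper s i1 c1 r1⟩
  · refine fun hcountT => hUunc (Set.countable_of_injective_of_countable_image hinj
      (hcountT.mono ?_))
    rintro _ ⟨s, hs, rfl⟩
    obtain ⟨i1, c1, r1⟩ := hUmem hs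
    exact ⟨s, i1, haper s i1 c1 r1, rfl⟩
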